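/- Write $f\sim g$ if each of the two quantities is bounded by the other up to positive multiplicative constants. A gauge function is an increasing continuous function $[0,\infty)\to[0,\infty)$ vanishing only at $0$; for a gauge function $\varphi$ and $E\subset\mathbb R^n$, the Hausdorff measure of $E$ is $\mathscr H^\varphi(E)=\lim_{\delta\to0^+}\inf\{\sum_i\varphi(d(E_i)) : E\subset\bigcup_{i=1}^\infty E_i,\ d(E_i)\le\delta\}$, where $d$ denotes the diameter. For a Young function $A$ (a non-trivial convex function $[0,\infty)\to[0,\infty]$ with $A(0)=0$), $V^{1,A}(\mathbb R^n,\mathbb R^n)$ is the homogeneous Orlicz–Sobolev space of those locally integrable, weakly differentiable maps $u:\mathbb R^n\to\mathbb R^n$ whose weak gradient satisfies $\int_{\mathbb R^n}A(|\nabla u|/\lambda)\,dx\le 1$ for some $\lambda>0$. Let $n\ge 1$ be an integer, let $A$ be a Young function such that $A(t)\sim t^n(\log t)^q$ near infinity for some $q>n-1$, and let $\varphi$ be a gauge function such that $\varphi(r)\sim(\log\frac1r)^\beta$ near zero for some $\beta<0$. Set $\sigma=\frac{n\beta}{n-q-1+\beta}$, let $\mu>1+\sigma$, and let $\Phi$ be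 a gauge function such that $\Phi(r)\sim r^\sigma(\log\frac1r)^\mu$ near zero. Then there exist a continuous map $u\in V^{1,A}(\mathbb R^n,\mathbb R^n)$ and a compact set $E\subset\mathbb R^n$ such that $$0<\mathscr H^\varphi(E)<\infty\qquad\text{and}\qquad\mathscr H^{\Phi}(u(E))=\infty.$$ -/

import Mathlib

open Filter Topology MeasureTheory
open scoped NNReal ENNReal ContDiff

/-- Two nonnegative extended functions bound each other along `l`, up to positive finite
multiplicative constants: `f ∼ g` along `l`. -/
def Comparable {α : Type*} (l : Filter α) (f g : α → ℝ≥0∞) : Prop :=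
  ∃ c C : ℝ≥0, 0 < c ∧ 0 < C ∧ ∀ᶠ x in l, c * g x ≤ f x ∧ f x ≤ C * g x

/-- Gauge functions `[0, ∞) → [0, ∞)`: increasing, continuous, vanishing only at `0`. -/
structure IsGauge (φ : ℝ≥0 → ℝ≥0) : Prop where
  monotone : Monotone φ
  continuous : Continuous φ
  eq_zero_iff : ∀ r, φ r = 0 ↔ r = 0

/-- The Hausdorff measure built upon the gauge function `φ` (sets of infinite diameter are not
admissible in coverings, whence the value `⊤`). -/
noncomputable def gaugeHausdorff {X : Type*} [MetricSpace X] [MeasurableSpace X] [BorelSpace X]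
    (φ : ℝ≥0 → ℝ≥0) : Measure X :=
  Measure.mkMetric fun d : ℝ≥0∞ => if d = ⊤ then ⊤ else (φ d.toNNReal : ℝ≥0∞)

/-- The measure `gaugeHausdorff φ` is given, on every set, by the usual formula. -/
theorem gaugeHausdorff_apply {X : Type*} [MetricSpace X] [MeasurableSpace X] [BorelSpace X]
    {φ : ℝ≥0 → ℝ≥0} (hφ : φ 0 = 0) (E : Set X) :
    gaugeHausdorff φ E =
      ⨆ (δ : ℝ≥0) (_ : 0 < δ),
        ⨅ (t : ℕ → Set X) (_ : E ⊆ ⋃ i, t i) (_ : ∀ i, Metric.ediam (t i) ≤ δ),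
          ∑' i, (φ (Metric.ediam (t i)).toNNReal : ℝ≥0∞) := by
  rw [gaugeHausdorff, Measure.mkMetric_apply]
  have key : ∀ (δ : ℝ≥0) (t : ℕ → Set X), (∀ i, Metric.ediam (t i) ≤ δ) →
      ∑' i, (⨆ _ : (t i).Nonempty, if Metric.ediam (t i) = ⊤ then (⊤ : ℝ≥0∞) else
        (φ (Metric.ediam (t i)).toNNReal : ℝ≥0∞)) =
      ∑' i, (φ (Metric.ediam (t i)).toNNReal : ℝ≥0∞) := by
    intro δ t ht
    refine tsum_congr fun i => ?_
    have h : Metric.ediam (t i) ≠ ⊤ := ne_top_of_le_ne_top ENNReal.coe_ne_top (ht i)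
    rcases (t i).eq_empty_or_nonempty with he | hne
    · simp [he, hφ]
    · simp [hne, h]
  apply le_antisymm
  · refine iSup₂_le fun r hr => ?_
    obtain ⟨δ, hδ0, hδr⟩ : ∃ δ : ℝ≥0, 0 < δ ∧ (δ : ℝ≥0∞) ≤ r := by
      obtain ⟨δ, h0, h1⟩ := ENNReal.lt_iff_exists_nnreal_btwn.1 hr
      exact ⟨δ, by exact_mod_cast h0, h1.le⟩
    refine le_iSup₂_of_le δ hδ0 ?_
    refine le_iInf fun t => le_iInf fun hE => le_iInf fun ht => ?_
    rw [← key δ t ht]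
    exact iInf_le_of_le t (iInf_le_of_le hE (iInf_le _ fun i => (ht i).trans hδr))
  · refine iSup₂_le fun δ hδ => ?_
    refine le_iSup₂_of_le (δ : ℝ≥0∞) (by exact_mod_cast hδ) ?_
    refine le_iInf fun t => le_iInf fun hE => le_iInf fun ht => ?_
    rw [key δ t ht]
    exact iInf_le_of_le t (iInf_le_of_le hE (iInf_le _ ht))

/-- Young functions `[0, ∞) → [0, ∞]`: convex, vanishing at `0`, and non trivial, i.e. neither
identically `0` nor identically `∞` on `(0, ∞)`. -/
structure IsYoung (A : ℝ≥0 → ℝ≥0∞) : Prop where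
  map_zero : A 0 = 0
  convex : ConvexOn ℝ≥0 Set.univ A
  exists_pos : ∃ t, 0 < A t
  exists_finite : ∃ t, 0 < t ∧ A t < ⊤

/-- The Luxemburg norm of `|f|`, with value `⊤` if no `r > 0` is admissible. -/
noncomputable def luxemburgNorm {X F : Type*} [MeasurableSpace X] [NormedAddCommGroup F]
    (A : ℝ≥0 → ℝ≥0∞) (μ : Measure X) (f : X → F) : ℝ≥0∞ :=
  ⨅ (r : ℝ≥0) (_ : 0 < r) (_ : ∫⁻ x, A (‖f x‖₊ / r) ∂μ ≤ 1), (r : ℝ≥0∞)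

/-- `|f|` belongs to the Orlicz space `L^A`. -/
def MemOrlicz {X F : Type*} [MeasurableSpace X] [NormedAddCommGroup F]
    (A : ℝ≥0 → ℝ≥0∞) (μ : Measure X) (f : X → F) : Prop :=
  AEStronglyMeasurable f μ ∧ luxemburgNorm A μ f < ⊤

/-- `G` is a weak gradient of `u` on the whole space: both are locally integrable, and integration
by parts holds against all smooth compactly supported test functions, in all directions. -/
structure IsWeakGradient {n m : ℕ} (u : EuclideanSpace ℝ (Fin n) → EuclideanSpace ℝ (Fin m))
    (G : EuclideanSpace ℝ (Fin n) → EuclideanSpace ℝ (Fin n) →L[ℝ] EuclideanSpace ℝ (Fin m)) :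
    Prop where
  locallyIntegrable : LocallyIntegrable u
  locallyIntegrable_gradient : LocallyIntegrable G
  integral_eq : ∀ η : EuclideanSpace ℝ (Fin n) → ℝ, ContDiff ℝ ∞ η → HasCompactSupport η →
    ∀ v : EuclideanSpace ℝ (Fin n), ∫ x, fderiv ℝ η x v • u x = -∫ x, η x • G x v

/-- The homogeneous Orlicz-Sobolev space `V^{1,A}(ℝⁿ, ℝᵐ)`. -/
def MemOrliczSobolev {n m : ℕ} (A : ℝ≥0 → ℝ≥0∞)
    (u : EuclideanSpace ℝ (Fin n) → EuclideanSpace ℝ (Fin m)) : Prop :=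
  ∃ G, IsWeakGradient u G ∧ MemOrlicz A volume G

/-! Both `E` and `u(E)` are Cantor sets coded by sequences of vertices of the unit cube: the code
`x` gives the point `∑ s k • digitVec (x k)` in the domain and `∑ ρ k • digitVec (x k)` in the
target. There are `2^(nk)` cubes of generation `k`, so the measure for a gauge is governed by
`2^(nk)` times the gauge at the `k`-th scale: covering by cylinders bounds it above, the Bernoulli
mass below.

For `φ` one takes `s k = exp(-κ Λ^k)` with `Λ^β = 2^(-n)`, so that this product stays bounded above
and below. For `Φ` one takes `ρ k = θ^k (k+1)^(-a)` with `θ^σ = 2^(-n)` and `a = 1 + 1/σ`; the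
product then has order at least `k^(μ-1-σ)`, which is unbounded.

The map `u` is a series of layers. Layer `k` adds `ρ k • digitVec` of the last letter on each cube,
damped by a logarithmic cut-off in the annulus between radii of order `s (k+1)` and `s k`. There the
gradient is at most of order `ρ k / (L k |x|)`, with `L k` of order `Λ^k`, and its `n`-th power
integrates to a logarithm. The energy of layer `k` is thus at most of order `2^(nk) (ρ k)^n
Λ^(k(q+1-n))`, up to the summable volume of the annuli. The formula for `σ` says exactly that `2^n
θ^n Λ^(q+1-n) = 1`: the exponential factors cancel and `∑ (k+1)^(-an)` remains. Different layers
have gradients with disjoint supports, so their energies add up. -/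

/-! ### Hausdorff measures of coded Cantor sets -/

/-- The uniform Bernoulli measure of a cylinder of length `j`. -/
theorem exists_bernoulli_measure (W : Type*) [Fintype W] [Nonempty W] [MeasurableSpace W]
    [MeasurableSingletonClass W] :
    ∃ ν : Measure (ℕ → W), ν Set.univ = 1 ∧ ∀ (x : ℕ → W) (j : ℕ),
      ν {y | ∀ i < j, y i = x i} = ((Fintype.card W : ℝ≥0∞) ^ j)⁻¹ := by
  refine ⟨Measure.infinitePi fun _ => (PMF.uniformOfFintype W).toMeasure, measure_univ, ?_⟩
  intro x j
  have h : {y : ℕ → W | ∀ i < j, y i = x i} =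
      Set.pi (Finset.range j : Finset ℕ) fun i => {x i} := by
    ext y; simp
  rw [h, Measure.infinitePi_pi _ fun i _ => measurableSet_singleton _]
  have : ∀ i, (PMF.uniformOfFintype W).toMeasure {x i} = (Fintype.card W : ℝ≥0∞)⁻¹ := by
    intro i
    rw [PMF.toMeasure_apply_singleton _ _ (measurableSet_singleton _),
      PMF.uniformOfFintype_apply]
  simp [this, ENNReal.inv_pow]

/-- Mass distribution principle for a coded Cantor set. -/
theorem le_gaugeHausdorff_range {W X : Type*} [Fintype W] [Nontrivial W]
    [MetricSpace X] [MeasurableSpace X] [BorelSpace X] {φ : ℝ≥0 → ℝ≥0} (hφ : IsGauge φ)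
    (f : (ℕ → W) → X) (γ : ℕ → ℝ≥0) (hγ0 : ∀ j, 0 < γ j) (hγa : Antitone γ)
    (hγ : Tendsto γ atTop (𝓝 0))
    (hsep : ∀ x y j, (∃ i ≤ j, x i ≠ y i) → γ j ≤ nndist (f x) (f y))
    (M : ℝ≥0) (hM : ∀ᶠ j in atTop, M ≤ φ (γ j) * (Fintype.card W : ℝ≥0) ^ j) :
    (M : ℝ≥0∞) ≤ gaugeHausdorff φ (Set.range f) := by
  let _ : MeasurableSpace W := ⊤
  obtain ⟨ν, hν1, hν⟩ := exists_bernoulli_measure W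
  obtain ⟨J, hJ⟩ := eventually_atTop.1 hM
  have hN0 : (Fintype.card W : ℝ≥0∞) ≠ 0 := by simp
  have hNt : (Fintype.card W : ℝ≥0∞) ≠ ⊤ := by simp
  have hcyl : ∀ (U : Set X) (j : ℕ), Metric.ediam U < γ j →
      ν (f ⁻¹' U) ≤ ((Fintype.card W : ℝ≥0∞) ^ (j + 1))⁻¹ := by
    intro U j hU
    rcases (f ⁻¹' U).eq_empty_or_nonempty with he | ⟨x, hx⟩
    · simp [he]
    · rw [← hν x (j + 1)]
      refine measure_mono fun y hy i hi => ?_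
      by_contra hne
      have h1 := hsep y x j ⟨i, by omega, hne⟩
      have h2 : edist (f y) (f x) ≤ Metric.ediam U := Metric.edist_le_ediam_of_mem hy hx
      rw [edist_nndist] at h2
      exact absurd (lt_of_le_of_lt h2 hU) (not_lt.2 (by exact_mod_cast h1))
  have hmass : ∀ U : Set X, Metric.ediam U < γ J →
      M * ν (f ⁻¹' U) ≤ φ (Metric.ediam U).toNNReal := by
    intro U hU
    have hUt : Metric.ediam U ≠ ⊤ := hU.ne_top
    obtain ⟨d, hd⟩ : ∃ d : ℝ≥0, (d : ℝ≥0∞) = Metric.ediam U := ⟨_, ENNReal.coe_toNNReal hUt⟩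
    rw [← hd, ENNReal.toNNReal_coe]
    -- No scale lies below diameter zero; such a set has null mass because the alphabet has at least
    -- two letters.
    rcases eq_or_ne d 0 with h0 | h0
    · have : ν (f ⁻¹' U) ≤ 0 := by
        have hlim : Tendsto (fun j : ℕ => ((Fintype.card W : ℝ≥0∞)⁻¹) ^ (j + 1)) atTop (𝓝 0) :=
          (ENNReal.tendsto_pow_atTop_nhds_zero_of_lt_one
            (ENNReal.inv_lt_one.2 (by exact_mod_cast Fintype.one_lt_card))).comp
            (tendsto_add_atTop_nat 1)
        refine ge_of_tendsto' hlim fun j => ?_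
        rw [← ENNReal.inv_pow]
        refine hcyl U j ?_
        rw [← hd, h0]
        exact_mod_cast hγ0 j
      simp [le_antisymm this bot_le]
    · have hex : ∃ j, γ j ≤ d := by
        obtain ⟨j, hj⟩ := (hγ.eventually (gt_mem_nhds (pos_iff_ne_zero.2 h0))).exists
        exact ⟨j, hj.le⟩
      classical
      -- With `j` the first scale not exceeding `d`, the set is too small to meet two cylinders of
      -- length `j`, while `φ d ≥ φ (γ j)`: the same index serves both bounds.
      set j := Nat.find hex with hj
      have hj1 : γ j ≤ d := Nat.find_spec hex
      have hJj : J < j := by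
        by_contra hcon
        have h1 : γ J ≤ γ j := hγa (not_lt.1 hcon)
        rw [← hd] at hU
        exact absurd (lt_of_lt_of_le (by exact_mod_cast hU) h1) (not_lt.2 hj1)
      obtain ⟨m, hm⟩ : ∃ m, j = m + 1 := ⟨j - 1, by omega⟩
      have hdm : d < γ m := not_le.1 (Nat.find_min hex (by omega))
      have h2 := hcyl U m (by rw [← hd]; exact_mod_cast hdm)
      rw [← hm] at h2
      calc (M : ℝ≥0∞) * ν (f ⁻¹' U)
          ≤ (φ (γ j) * (Fintype.card W : ℝ≥0∞) ^ j) * ((Fintype.card W : ℝ≥0∞) ^ j)⁻¹ := by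
            gcongr
            exact_mod_cast hJ j hJj.le
        _ = φ (γ j) := by
            rw [mul_assoc, ENNReal.mul_inv_cancel (pow_ne_zero _ hN0) (ENNReal.pow_ne_top hNt),
              mul_one]
        _ ≤ φ d := by exact_mod_cast hφ.monotone hj1
  rw [gaugeHausdorff_apply ((hφ.eq_zero_iff 0).2 rfl)]
  refine le_iSup₂_of_le (γ J / 2) (half_pos (hγ0 J)) ?_
  refine le_iInf fun t => le_iInf fun hE => le_iInf fun ht => ?_
  -- Only monotonicity and countable subadditivity of `ν` enter, so the preimages need not be
  -- measurable.
  calc (M : ℝ≥0∞) = M * ν Set.univ := by rw [hν1, mul_one]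
    _ ≤ M * ν (⋃ i, f ⁻¹' (t i)) := by
        gcongr
        intro x _
        simpa using hE ⟨x, rfl⟩
    _ ≤ M * ∑' i, ν (f ⁻¹' (t i)) := by gcongr; exact measure_iUnion_le _
    _ = ∑' i, M * ν (f ⁻¹' (t i)) := ENNReal.tsum_mul_left.symm
    _ ≤ _ := ENNReal.tsum_le_tsum fun i => hmass _ <|
        (ht i).trans_lt (by exact_mod_cast half_lt_self (hγ0 J))

/-- Covering bound for a coded Cantor set. -/
theorem gaugeHausdorff_range_le {W X : Type*} [Fintype W]
    [MetricSpace X] [MeasurableSpace X] [BorelSpace X] {φ : ℝ≥0 → ℝ≥0} (hφ : IsGauge φ)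
    (f : (ℕ → W) → X) (d : ℕ → ℝ≥0) (hd : Tendsto d atTop (𝓝 0))
    (hdist : ∀ x y j, (∀ i < j, x i = y i) → nndist (f x) (f y) ≤ d j)
    (M : ℝ≥0) (hM : ∀ᶠ j in atTop, (Fintype.card W : ℝ≥0) ^ j * φ (d j) ≤ M) :
    gaugeHausdorff φ (Set.range f) ≤ M := by
  classical
  have hdiam : ∀ (j : ℕ) (w : Fin j → W),
      Metric.ediam (f '' {x | ∀ i : Fin j, x i = w i}) ≤ d j := by
    intro j w
    refine Metric.ediam_le ?_
    rintro _ ⟨x, hx, rfl⟩ _ ⟨y, hy, rfl⟩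
    rw [edist_nndist]
    exact_mod_cast hdist x y j fun i hi => (hx ⟨i, hi⟩).trans (hy ⟨i, hi⟩).symm
  refine (Measure.mkMetric_le_liminf_sum (ι := fun j : ℕ => Fin j → W) (Set.range f) (l := atTop)
    (fun j => (d j : ℝ≥0∞)) (by rw [← ENNReal.coe_zero]; exact ENNReal.tendsto_coe.2 hd)
    (fun j w => f '' {x | ∀ i : Fin j, x i = w i}) (Eventually.of_forall hdiam)
    (Eventually.of_forall ?_) _).trans ?_
  · rintro j _ ⟨x, rfl⟩
    exact Set.mem_iUnion.2 ⟨fun i => x i, x, fun i => rfl, rfl⟩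
  · refine liminf_le_of_frequently_le' (Eventually.frequently ?_)
    filter_upwards [hM] with j hj
    calc _ ≤ ∑ w : Fin j → W, (φ (d j) : ℝ≥0∞) := by
          refine Finset.sum_le_sum fun w _ => ?_
          have h1 := ne_top_of_le_ne_top ENNReal.coe_ne_top (hdiam j w)
          rw [if_neg h1]
          have h2 : (Metric.ediam (f '' {x | ∀ i : Fin j, x i = w i})).toNNReal ≤ d j := by
            simpa using ENNReal.toNNReal_mono ENNReal.coe_ne_top (hdiam j w)
          exact_mod_cast hφ.monotone h2
      _ = (Fintype.card W : ℝ≥0∞) ^ j * φ (d j) := by simp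
      _ ≤ M := by exact_mod_cast hj

/-! ### Digit series with geometrically decaying scales -/

theorem geometric_decay {s : ℕ → ℝ} {τ : ℝ} (hτ0 : 0 ≤ τ) (hs : ∀ k, s (k + 1) ≤ τ * s k)
    (k j : ℕ) : s (k + j) ≤ τ ^ j * s k := by
  induction j with
  | zero => simp
  | succ j ih =>
    calc s (k + j + 1) ≤ τ * s (k + j) := hs _
      _ ≤ τ * (τ ^ j * s k) := by gcongr
      _ = τ ^ (j + 1) * s k := by ring

theorem antitone_of_geometric_decay {s : ℕ → ℝ} {τ : ℝ} (hτ1 : τ ≤ 1)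
    (hs0 : ∀ k, 0 < s k) (hs : ∀ k, s (k + 1) ≤ τ * s k) : Antitone s :=
  antitone_nat_of_succ_le fun k => (hs k).trans (by nlinarith [hs0 k])

theorem summable_of_geometric_decay {s : ℕ → ℝ} {τ : ℝ} (hτ0 : 0 ≤ τ) (hτ1 : τ < 1)
    (hs0 : ∀ k, 0 < s k) (hs : ∀ k, s (k + 1) ≤ τ * s k) : Summable s := by
  refine Summable.of_nonneg_of_le (fun k => (hs0 k).le) (fun k => ?_)
    ((summable_geometric_of_lt_one hτ0 hτ1).mul_right (s 0))
  simpa using geometric_decay hτ0 hs 0 k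

theorem abs_tsum_mul_le {s d : ℕ → ℝ} {τ : ℝ} (hτ0 : 0 ≤ τ) (hτ1 : τ < 1)
    (hs0 : ∀ k, 0 < s k) (hs : ∀ k, s (k + 1) ≤ τ * s k) (hd : ∀ k, |d k| ≤ 1) (j : ℕ)
    (hj : ∀ i < j, d i = 0) : |∑' k, s k * d k| ≤ s j / (1 - τ) := by
  have hle : ∀ k, ‖s k * d k‖ ≤ s k := fun k => by
    rw [Real.norm_eq_abs, abs_mul, abs_of_pos (hs0 k)]
    exact mul_le_of_le_one_right (hs0 k).le (hd k)
  have hsum : Summable fun k => s k * d k :=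
    (summable_of_geometric_decay hτ0 hτ1 hs0 hs).of_norm_bounded hle
  have h0 : ∑ i ∈ Finset.range j, s i * d i = 0 :=
    Finset.sum_eq_zero fun i hi => by rw [hj i (Finset.mem_range.1 hi), mul_zero]
  rw [← hsum.sum_add_tsum_nat_add j, h0, zero_add, ← Real.norm_eq_abs]
  have hg : HasSum (fun m : ℕ => τ ^ m * s j) (s j / (1 - τ)) := by
    have := (hasSum_geometric_of_lt_one hτ0 hτ1).mul_right (s j)
    rwa [inv_mul_eq_div] at this
  refine tsum_of_norm_bounded hg fun m => (hle _).trans ?_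
  rw [add_comm]
  exact geometric_decay hτ0 hs j m

/-- The first nonzero digit contributes exactly `s j`, and all later ones together at most `τ s j /
(1 - τ)`. The difference is a useful bound when `τ < 1/2`. -/
theorem le_abs_tsum_mul {s d : ℕ → ℝ} {τ : ℝ} (hτ0 : 0 ≤ τ) (hτ1 : τ < 1)
    (hs0 : ∀ k, 0 < s k) (hs : ∀ k, s (k + 1) ≤ τ * s k) (hd : ∀ k, |d k| ≤ 1) (j : ℕ)
    (hj : ∀ i < j, d i = 0) (hdj : |d j| = 1) :
    s j * ((1 - 2 * τ) / (1 - τ)) ≤ |∑' k, s k * d k| := by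
  set d' : ℕ → ℝ := fun k => if k = j then 0 else d k with hd'
  have hd'1 : ∀ k, |d' k| ≤ 1 := fun k => by
    by_cases h : k = j
    · simp [hd', h]
    · simpa [hd', h] using hd k
  have hb := abs_tsum_mul_le hτ0 hτ1 hs0 hs hd'1 (j + 1) fun i hi => by
    by_cases h : i = j
    · simp [hd', h]
    · simpa [hd', h] using hj i (by omega)
  have hle : ∀ k, ‖s k * d k‖ ≤ s k := fun k => by
    rw [Real.norm_eq_abs, abs_mul, abs_of_pos (hs0 k)]
    exact mul_le_of_le_one_right (hs0 k).le (hd k)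
  have hsum : Summable fun k => s k * d k :=
    (summable_of_geometric_decay hτ0 hτ1 hs0 hs).of_norm_bounded hle
  have heq : ∑' k, s k * d k = s j * d j + ∑' k, s k * d' k := by
    rw [hsum.tsum_eq_add_tsum_ite j]
    congr 1
    refine tsum_congr fun k => ?_
    by_cases h : k = j <;> simp [hd', h]
  have h1 : |s j * d j| = s j := by rw [abs_mul, hdj, mul_one, abs_of_pos (hs0 j)]
  have h2 : |s j * d j| ≤ |∑' k, s k * d k| + |∑' k, s k * d' k| := by
    rw [show s j * d j = ∑' k, s k * d k - ∑' k, s k * d' k by rw [heq]; ring]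
    exact abs_sub _ _
  have h3 : s (j + 1) / (1 - τ) ≤ τ * s j / (1 - τ) :=
    div_le_div_of_nonneg_right (hs j) (by linarith)
  have h4 : s j * ((1 - 2 * τ) / (1 - τ)) = s j - τ * s j / (1 - τ) := by
    have : 1 - τ ≠ 0 := by linarith
    field_simp
    ring
  linarith

/-! ### Cantor sets in Euclidean space -/

/-- The vertex of the unit cube with the given binary coordinates. -/
noncomputable def digitVec {n : ℕ} (w : Fin n → Bool) : EuclideanSpace ℝ (Fin n) :=
  WithLp.toLp 2 fun i => bif w i then 1 else 0

/-- The point of the Cantor set with scales `s` coded by a sequence of vertices. -/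
noncomputable def digitMap {n : ℕ} (s : ℕ → ℝ) (x : ℕ → Fin n → Bool) :
    EuclideanSpace ℝ (Fin n) :=
  WithLp.toLp 2 fun i => ∑' k, s k * (bif x k i then 1 else 0)

theorem EuclideanSpace.norm_le_mul_of_abs_le {n : ℕ} {v : EuclideanSpace ℝ (Fin n)} {c : ℝ}
    (h : ∀ i, |v i| ≤ c) : ‖v‖ ≤ n * c := by
  rcases Nat.eq_zero_or_pos n with rfl | hn
  · simp [Subsingleton.elim v 0]
  have hc : 0 ≤ c := (abs_nonneg _).trans (h ⟨0, hn⟩)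
  rw [EuclideanSpace.norm_eq]
  refine Real.sqrt_le_iff.2 ⟨by positivity, ?_⟩
  calc ∑ i, ‖v i‖ ^ 2 ≤ ∑ _i : Fin n, c ^ 2 :=
        Finset.sum_le_sum fun i _ => pow_le_pow_left₀ (norm_nonneg _) (h i) 2
    _ = n * c ^ 2 := by simp
    _ ≤ (n : ℝ) ^ 2 * c ^ 2 := by
        gcongr
        exact_mod_cast Nat.le_self_pow (by norm_num) n
    _ = (n * c) ^ 2 := by ring

theorem norm_digitVec_le {n : ℕ} (w : Fin n → Bool) : ‖digitVec w‖ ≤ n := by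
  have := EuclideanSpace.norm_le_mul_of_abs_le (v := digitVec w) (c := 1) fun i => by
    cases h : w i <;> simp [digitVec, h]
  simpa using this

section digitMap

variable {n : ℕ} {s : ℕ → ℝ} {τ : ℝ}

theorem summable_mul_digit (hs0 : ∀ k, 0 < s k) (hs : Summable s) (b : ℕ → Bool) :
    Summable fun k => s k * (bif b k then 1 else 0) := by
  refine hs.of_norm_bounded fun k => ?_
  cases b k <;> simp [(hs0 k).le, abs_of_pos (hs0 k)]

theorem digitMap_sub_apply (hs0 : ∀ k, 0 < s k) (hs : Summable s) (x y : ℕ → Fin n → Bool)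
    (i : Fin n) : (digitMap s x - digitMap s y) i =
      ∑' k, s k * ((bif x k i then 1 else 0) - (bif y k i then 1 else 0)) := by
  simp only [mul_sub]
  rw [(summable_mul_digit hs0 hs fun k => x k i).tsum_sub
    (summable_mul_digit hs0 hs fun k => y k i)]
  rfl

theorem dist_digitMap_le (hτ0 : 0 ≤ τ) (hτ1 : τ < 1) (hs0 : ∀ k, 0 < s k)
    (hs : ∀ k, s (k + 1) ≤ τ * s k) {x y : ℕ → Fin n → Bool} {j : ℕ}
    (h : ∀ i < j, x i = y i) : dist (digitMap s x) (digitMap s y) ≤ n * (s j / (1 - τ)) := by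
  rw [dist_eq_norm]
  refine EuclideanSpace.norm_le_mul_of_abs_le fun i => ?_
  rw [digitMap_sub_apply hs0 (summable_of_geometric_decay hτ0 hτ1 hs0 hs)]
  refine abs_tsum_mul_le hτ0 hτ1 hs0 hs (fun k => ?_) j fun k hk => ?_
  · cases x k i <;> cases y k i <;> simp
  · simp [h k hk]

/-- At the first index where the codes differ, some coordinate of the letters differs by `1`; the
norm dominates that coordinate, and the scale there is at least `s j`. -/
theorem le_dist_digitMap (hτ0 : 0 ≤ τ) (hτ1 : τ < 1 / 2) (hs0 : ∀ k, 0 < s k)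
    (hs : ∀ k, s (k + 1) ≤ τ * s k) {x y : ℕ → Fin n → Bool} {j : ℕ}
    (h : ∃ i ≤ j, x i ≠ y i) :
    s j * ((1 - 2 * τ) / (1 - τ)) ≤ dist (digitMap s x) (digitMap s y) := by
  classical
  have hτ1' : τ < 1 := by linarith
  have hex : ∃ i, x i ≠ y i := h.imp fun i hi => hi.2
  obtain ⟨i, hij, hi⟩ := h
  have hm : Nat.find hex ≤ j := (Nat.find_min' hex hi).trans hij
  obtain ⟨l, hl⟩ := Function.ne_iff.1 (Nat.find_spec hex)
  rw [dist_eq_norm]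
  refine le_trans ?_ (PiLp.norm_apply_le _ l)
  rw [digitMap_sub_apply hs0 (summable_of_geometric_decay hτ0 hτ1' hs0 hs)]
  refine le_trans ?_ (le_abs_tsum_mul hτ0 hτ1' hs0 hs (fun k => ?_) (Nat.find hex)
    (fun k hk => ?_) ?_)
  · have : 0 ≤ (1 - 2 * τ) / (1 - τ) := div_nonneg (by linarith) (by linarith)
    gcongr
    exact antitone_of_geometric_decay hτ1'.le hs0 hs hm
  · cases x k l <;> cases y k l <;> simp
  · have := Nat.find_min hex hk
    simp only [not_not] at this
    simp [this]
  · revert hl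
    cases x (Nat.find hex) l <;> cases y (Nat.find hex) l <;> simp

theorem hasSum_digitMap (hs0 : ∀ k, 0 < s k) (hs : Summable s) (x : ℕ → Fin n → Bool) :
    HasSum (fun k => s k • digitVec (x k)) (digitMap s x) := by
  have hsum : Summable fun k => s k • digitVec (x k) := by
    refine (hs.mul_right (n : ℝ)).of_norm_bounded fun k => ?_
    rw [norm_smul, Real.norm_of_nonneg (hs0 k).le]
    exact mul_le_mul_of_nonneg_left (norm_digitVec_le _) (hs0 k).le
  convert hsum.hasSum using 1
  ext i
  have := (EuclideanSpace.proj i : EuclideanSpace ℝ (Fin n) →L[ℝ] ℝ).map_tsum hsum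
  exact this.symm

theorem continuous_digitMap (hs0 : ∀ k, 0 < s k) (hs : Summable s) :
    Continuous (digitMap s : (ℕ → Fin n → Bool) → EuclideanSpace ℝ (Fin n)) := by
  refine (PiLp.continuous_toLp 2 _).comp (continuous_pi fun i => ?_)
  refine continuous_tsum (fun k => ?_) hs fun k x => ?_
  · have h : Continuous fun b : Bool => s k * (bif b then 1 else 0) :=
      continuous_of_discreteTopology
    exact h.comp ((continuous_apply i).comp (continuous_apply k))
  · cases x k i <;> simp [(hs0 k).le, abs_of_pos (hs0 k)]

end digitMap

/-! ### Logarithmic cut-offs -/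

theorem Real.smoothTransition.exists_abs_deriv_le :
    ∃ C : ℝ, 0 < C ∧ ∀ t, |deriv Real.smoothTransition t| ≤ C := by
  have hc : Continuous (deriv Real.smoothTransition) :=
    (Real.smoothTransition.contDiff (n := 1)).continuous_deriv le_rfl
  obtain ⟨C, hC⟩ := (isCompact_Icc (a := (0 : ℝ)) (b := 1)).exists_bound_of_continuousOn
    hc.continuousOn
  refine ⟨max C 1, by positivity, fun t => ?_⟩
  by_cases ht : t ∈ Set.Icc (0 : ℝ) 1
  · exact (hC t ht).trans (le_max_left _ _)
  · have h0 : deriv Real.smoothTransition t = 0 := by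
      rcases lt_or_ge t 0 with h | h
      · refine IsLocalMin.deriv_eq_zero (Eventually.of_forall fun y => ?_)
        rw [Real.smoothTransition.zero_of_nonpos h.le]
        exact Real.smoothTransition.nonneg y
      · have h1 : 1 < t := by
          by_contra hcon
          exact ht ⟨h, not_lt.1 hcon⟩
        refine IsLocalMax.deriv_eq_zero (Eventually.of_forall fun y => ?_)
        rw [Real.smoothTransition.one_of_one_le h1.le]
        exact Real.smoothTransition.le_one y
    rw [h0, abs_zero]
    positivity

section logCutoff

variable {V : Type*} [NormedAddCommGroup V]

/-- A smooth logarithmic cut-off: it equals `1` on the ball of radius `r`, if `L` is at most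
`log (R² / 2r²)`, and vanishes off the ball of radius `R`. -/
noncomputable def logCutoff (r R L : ℝ) (x : V) : ℝ :=
  Real.smoothTransition (Real.log (R ^ 2 / (‖x‖ ^ 2 + r ^ 2)) / L)

theorem logCutoff_nonneg (r R L : ℝ) (x : V) : 0 ≤ logCutoff r R L x :=
  Real.smoothTransition.nonneg _

theorem logCutoff_le_one (r R L : ℝ) (x : V) : logCutoff r R L x ≤ 1 :=
  Real.smoothTransition.le_one _

theorem logCutoff_eq_zero {r R L : ℝ} (hr : 0 < r) (hR : 0 < R) (hL : 0 < L) {x : V}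
    (hx : R ≤ ‖x‖) : logCutoff r R L x = 0 := by
  refine Real.smoothTransition.zero_of_nonpos (div_nonpos_of_nonpos_of_nonneg ?_ hL.le)
  refine Real.log_nonpos (by positivity) ((div_le_one (by positivity)).2 ?_)
  nlinarith [pow_le_pow_left₀ hR.le hx 2]

theorem logCutoff_eq_one {r R L : ℝ} (hr : 0 < r) (hR : 0 < R) (hL : 0 < L)
    (hLR : L ≤ Real.log (R ^ 2 / (2 * r ^ 2))) {x : V} (hx : ‖x‖ ≤ r) :
    logCutoff r R L x = 1 := by
  refine Real.smoothTransition.one_of_one_le ((one_le_div hL).2 (hLR.trans ?_))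
  refine Real.log_le_log (by positivity) ?_
  gcongr
  nlinarith [pow_le_pow_left₀ (norm_nonneg x) hx 2]

variable [InnerProductSpace ℝ V]

theorem contDiff_logCutoff {r R L : ℝ} (hr : 0 < r) (hR : 0 < R) :
    ContDiff ℝ ∞ (logCutoff r R L : V → ℝ) := by
  have hpos : ∀ x : V, ‖x‖ ^ 2 + r ^ 2 ≠ 0 := fun x => by positivity
  refine Real.smoothTransition.contDiff.comp (ContDiff.div_const (ContDiff.log ?_ ?_) L)
  · exact contDiff_const.div ((contDiff_norm_sq ℝ).add contDiff_const) hpos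
  · intro x
    have := hpos x
    positivity

/-- Where the cut-off takes its least value it has a global minimum; this also covers the boundary
sphere, where it is not locally constant a priori. -/
theorem fderiv_logCutoff_eq_zero_of_le {r R L : ℝ} (hr : 0 < r) (hR : 0 < R) (hL : 0 < L)
    {x : V} (hx : R ≤ ‖x‖) : fderiv ℝ (logCutoff r R L) x = 0 :=
  IsLocalMin.fderiv_eq_zero <| Eventually.of_forall fun y => by
    rw [logCutoff_eq_zero hr hR hL hx]
    exact logCutoff_nonneg r R L y

theorem fderiv_logCutoff_eq_zero_of_ge {r R L : ℝ} (hr : 0 < r) (hR : 0 < R) (hL : 0 < L)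
    (hLR : L ≤ Real.log (R ^ 2 / (2 * r ^ 2))) {x : V} (hx : ‖x‖ ≤ r) :
    fderiv ℝ (logCutoff r R L) x = 0 :=
  IsLocalMax.fderiv_eq_zero <| Eventually.of_forall fun y => by
    rw [logCutoff_eq_one hr hR hL hLR hx]
    exact logCutoff_le_one r R L y

/-- The gradient of `log (‖x‖² + r²)` is at most `2 / ‖x‖`, whatever the regularization `r`. This
decay is the borderline one in dimension `n`. -/
theorem norm_fderiv_logCutoff_le {C : ℝ} (hC : ∀ t, |deriv Real.smoothTransition t| ≤ C)
    {r R L : ℝ} (hr : 0 < r) (hR : 0 < R) (hL : 0 < L) {x : V} (hx : x ≠ 0) :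
    ‖fderiv ℝ (logCutoff r R L) x‖ ≤ 2 * C / (L * ‖x‖) := by
  have hC0 : 0 ≤ C := (abs_nonneg _).trans (hC 0)
  have hx0 : 0 < ‖x‖ := norm_pos_iff.2 hx
  have hfun : (logCutoff r R L : V → ℝ) = fun x =>
      Real.smoothTransition ((Real.log (R ^ 2) - Real.log (‖x‖ ^ 2 + r ^ 2)) / L) := by
    funext y
    rw [logCutoff, Real.log_div (by positivity) (by positivity)]
  have h1 : HasFDerivAt (fun y : V => ‖y‖ ^ 2 + r ^ 2) (2 • innerSL ℝ x) x :=
    ((hasStrictFDerivAt_norm_sq x).hasFDerivAt).add_const _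
  have h2 := (((h1.log (by positivity)).const_sub (Real.log (R ^ 2))).mul_const L⁻¹)
  have h3 : HasDerivAt Real.smoothTransition
      (deriv Real.smoothTransition ((Real.log (R ^ 2) - Real.log (‖x‖ ^ 2 + r ^ 2)) * L⁻¹))
      ((Real.log (R ^ 2) - Real.log (‖x‖ ^ 2 + r ^ 2)) * L⁻¹) :=
    ((Real.smoothTransition.contDiff (n := 1)).differentiable one_ne_zero _).hasDerivAt
  have h4 := h3.comp_hasFDerivAt x h2
  rw [hfun]
  simp only [div_eq_mul_inv]
  erw [h4.fderiv]
  have h5 : ‖(2 • innerSL ℝ x : V →L[ℝ] ℝ)‖ ≤ 2 * ‖x‖ := by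
    refine (norm_nsmul_le).trans ?_
    simp
  rw [norm_smul, norm_smul, norm_neg, norm_smul]
  have h6 : ‖(‖x‖ ^ 2 + r ^ 2)⁻¹‖ ≤ (‖x‖ ^ 2)⁻¹ := by
    rw [Real.norm_of_nonneg (by positivity)]
    gcongr
    nlinarith [sq_nonneg r]
  calc _ ≤ C * (L⁻¹ * ((‖x‖ ^ 2)⁻¹ * (2 * ‖x‖))) := by
        rw [Real.norm_of_nonneg (inv_nonneg.2 hL.le)]
        gcongr
        exact hC _
    _ = 2 * C * (L * ‖x‖)⁻¹ := by
        field_simp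

end logCutoff

/-! ### Radial integrals over annuli -/

/-- The majorant of the modular of a logarithmic cut-off, on an annulus. -/
noncomputable def annulusMajorant (n : ℕ) (r R M t : ℝ) : ℝ :=
  (Set.Ioo r R).indicator (fun t => 1 + M * (t ^ n)⁻¹) t

theorem annulusMajorant_nonneg {n : ℕ} {r R M t : ℝ} (hr : 0 < r) (hM : 0 ≤ M) :
    0 ≤ annulusMajorant n r R M t := by
  refine Set.indicator_nonneg (fun t ht => ?_) t
  have : 0 < t := hr.trans ht.1
  positivity

/-- In polar coordinates the weight `t^(n-1)` turns `M t^(-n)` into `M / t`, whose integral is the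
logarithm. -/
theorem integral_annulusMajorant_le {n : ℕ} (hn : 1 ≤ n) {r R M : ℝ} (hr : 0 < r) (hrR : r ≤ R) :
    Integrable (fun x : EuclideanSpace ℝ (Fin n) => annulusMajorant n r R M ‖x‖) ∧
    ∫ x : EuclideanSpace ℝ (Fin n), annulusMajorant n r R M ‖x‖ ≤
      n * volume.real (Metric.ball (0 : EuclideanSpace ℝ (Fin n)) 1) *
        (R ^ n + M * Real.log (R / r)) := by
  have : Nontrivial (EuclideanSpace ℝ (Fin n)) :=
    haveI : Nonempty (Fin n) := ⟨⟨0, hn⟩⟩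
    inferInstance
  have hfr : Module.finrank ℝ (EuclideanSpace ℝ (Fin n)) = n := by simp
  have hR : 0 < R := hr.trans_le hrR
  have heq : ∀ y : ℝ, y ^ (n - 1) • annulusMajorant n r R M y =
      (Set.Ioo r R).indicator (fun t => t ^ (n - 1) + M * t⁻¹) y := by
    intro y
    unfold annulusMajorant
    by_cases hy : y ∈ Set.Ioo r R
    · have hy0 : 0 < y := hr.trans hy.1
      rw [Set.indicator_of_mem hy, Set.indicator_of_mem hy, smul_eq_mul]
      obtain ⟨m, rfl⟩ : ∃ m, n = m + 1 := ⟨n - 1, by omega⟩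
      simp only [Nat.add_sub_cancel]
      field_simp
      ring
    · rw [Set.indicator_of_notMem hy, Set.indicator_of_notMem hy, smul_zero]
  have hcont : ContinuousOn (fun t : ℝ => t ^ (n - 1) + M * t⁻¹) (Set.uIcc r R) := by
    rw [Set.uIcc_of_le hrR]
    refine (continuousOn_pow _).add (continuousOn_const.mul (continuousOn_inv₀.mono ?_))
    intro t ht
    exact (hr.trans_le ht.1).ne'
  have hint : IntegrableOn (fun t : ℝ => t ^ (n - 1) + M * t⁻¹) (Set.Ioo r R) := by
    have := hcont.intervalIntegrable (μ := volume)
    rw [intervalIntegrable_iff_integrableOn_Ioo_of_le hrR] at this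
    exact this
  have hsub : Set.Ioo r R ⊆ Set.Ioi 0 := fun t ht => hr.trans ht.1
  constructor
  · rw [integrable_fun_norm_addHaar (μ := volume) (f := annulusMajorant n r R M), hfr]
    simp only [heq]
    exact (hint.integrable_indicator measurableSet_Ioo).integrableOn
  · rw [integral_fun_norm_addHaar volume (annulusMajorant n r R M), hfr]
    simp only [heq]
    rw [setIntegral_indicator measurableSet_Ioo, Set.inter_eq_right.2 hsub,
      ← integral_Ioc_eq_integral_Ioo, ← intervalIntegral.integral_of_le hrR,
      intervalIntegral.integral_add, intervalIntegral.integral_const_mul, integral_pow,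
      integral_inv_of_pos hr hR, nsmul_eq_mul, smul_eq_mul, ← mul_assoc]
    · gcongr
      have h1 : ((n - 1 : ℕ) : ℝ) + 1 = n := by
        rw [Nat.cast_sub hn]; simp
      have h2 : (1 : ℝ) ≤ n := by exact_mod_cast hn
      rw [h1, Nat.sub_add_cancel hn, div_le_iff₀ (by linarith)]
      have h3 : 0 ≤ r ^ n := by positivity
      have h4 : 0 ≤ R ^ n := by positivity
      nlinarith
    · exact (continuous_pow _).intervalIntegrable _ _
    · refine ContinuousOn.intervalIntegrable ?_
      rw [Set.uIcc_of_le hrR]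
      refine continuousOn_const.mul (continuousOn_inv₀.mono ?_)
      intro t ht
      exact (hr.trans_le ht.1).ne'

/-! ### Weak gradients of series -/

theorem integrable_tsum_of_summable_integral_norm {α F : Type*} [MeasurableSpace α]
    {μ : Measure α} [NormedAddCommGroup F] [NormedSpace ℝ F] [MeasurableSpace F] [BorelSpace F]
    [SecondCountableTopology F] [CompleteSpace F] {f : ℕ → α → F}
    (hm : ∀ k, Measurable (f k)) (hf : ∀ k, Integrable (f k) μ)
    (hs : Summable fun k => ∫ a, ‖f k a‖ ∂μ) : Integrable (fun a => ∑' k, f k a) μ := by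
  refine ⟨(Measurable.tsum hm).aestronglyMeasurable, ?_⟩
  refine lt_of_le_of_lt (lintegral_mono fun a => enorm_tsum_le_tsum_enorm) ?_
  rw [lintegral_tsum fun k => (hf k).1.enorm]
  have h : ∀ k, ∫⁻ a, ‖f k a‖ₑ ∂μ = ENNReal.ofReal (∫ a, ‖f k a‖ ∂μ) := fun k =>
    (ofReal_integral_norm_eq_lintegral_enorm (hf k)).symm
  simp only [h]
  rw [← ENNReal.ofReal_tsum_of_nonneg (fun k => integral_nonneg fun a => norm_nonneg _) hs]
  exact ENNReal.ofReal_lt_top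

/-- Each term is integrated by parts against the test function. Sum and integral are exchanged by
the uniform bounds `a k` on one side and by the `L¹` norms of the gradients on the other. -/
theorem isWeakGradient_tsum {n m : ℕ}
    {U : ℕ → EuclideanSpace ℝ (Fin n) → EuclideanSpace ℝ (Fin m)} {a : ℕ → ℝ}
    (hU : ∀ k, ContDiff ℝ 1 (U k)) (ha : Summable a) (hUa : ∀ k x, ‖U k x‖ ≤ a k)
    (hint : ∀ k, Integrable (fderiv ℝ (U k)))
    (hsum : Summable fun k => ∫ x, ‖fderiv ℝ (U k) x‖) :
    IsWeakGradient (fun x => ∑' k, U k x) (fun x => ∑' k, fderiv ℝ (U k) x) := by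
  have hcont : Continuous fun x => ∑' k, U k x :=
    continuous_tsum (fun k => (hU k).continuous) ha hUa
  have hdc : ∀ k, Continuous (fderiv ℝ (U k)) := fun k => (hU k).continuous_fderiv one_ne_zero
  have hG := integrable_tsum_of_summable_integral_norm (fun k => (hdc k).measurable) hint hsum
  refine ⟨hcont.locallyIntegrable, hG.locallyIntegrable, fun η hη hηc v => ?_⟩
  have hηd : Continuous fun x => fderiv ℝ η x v :=
    (hη.continuous_fderiv (by simp)).clm_apply continuous_const
  have hηdc : HasCompactSupport fun x => fderiv ℝ η x v := hηc.fderiv_apply ℝ v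
  have hterm : ∀ k, ∫ x, η x • fderiv ℝ (U k) x v = -∫ x, fderiv ℝ η x v • U k x := by
    intro k
    refine integral_smul_fderiv_eq_neg_fderiv_smul_of_integrable ?_ ?_ ?_
      (fun x _ => (hη.differentiable (by simp)) x)
      (fun x _ => ((hU k).differentiable one_ne_zero) x)
    · exact (hηd.smul (hU k).continuous).integrable_of_hasCompactSupport hηdc.smul_right
    · exact (hη.continuous.smul ((hdc k).clm_apply continuous_const)).integrable_of_hasCompactSupport
        hηc.smul_right
    · exact (hη.continuous.smul (hU k).continuous).integrable_of_hasCompactSupport hηc.smul_right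
  have hs1 : HasSum (fun k => ∫ x, fderiv ℝ η x v • U k x)
      (∫ x, ∑' k, fderiv ℝ η x v • U k x) := by
    refine hasSum_integral_of_summable_integral_norm (fun k => ?_) ?_
    · exact (hηd.smul (hU k).continuous).integrable_of_hasCompactSupport hηdc.smul_right
    · refine Summable.of_nonneg_of_le (fun k => integral_nonneg fun x => norm_nonneg _)
        (fun k => ?_) (ha.mul_left (∫ x, ‖fderiv ℝ η x v‖))
      rw [← integral_mul_const]
      have hi : Integrable fun x => ‖fderiv ℝ η x v‖ :=
        (hηd.integrable_of_hasCompactSupport hηdc).norm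
      refine integral_mono_of_nonneg (Eventually.of_forall fun x => norm_nonneg _)
        (hi.mul_const _) (Eventually.of_forall fun x => ?_)
      change ‖fderiv ℝ η x v • U k x‖ ≤ _
      rw [norm_smul]
      exact mul_le_mul_of_nonneg_left (hUa k x) (norm_nonneg _)
  obtain ⟨B, hB⟩ : ∃ B, ∀ x, ‖η x‖ ≤ B := hη.continuous.bounded_above_of_compact_support hηc
  have hi2 : ∀ k, Integrable fun x => η x • fderiv ℝ (U k) x v := fun k =>
    (hη.continuous.smul ((hdc k).clm_apply continuous_const)).integrable_of_hasCompactSupport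
        hηc.smul_right
  have hs2 : HasSum (fun k => ∫ x, η x • fderiv ℝ (U k) x v)
      (∫ x, ∑' k, η x • fderiv ℝ (U k) x v) := by
    refine hasSum_integral_of_summable_integral_norm hi2 ?_
    refine Summable.of_nonneg_of_le (fun k => integral_nonneg fun x => norm_nonneg _)
      (fun k => ?_) (hsum.mul_left (B * ‖v‖))
    rw [← integral_const_mul]
    refine integral_mono_of_nonneg (Eventually.of_forall fun x => norm_nonneg _)
        ((hint k).norm.const_mul _) (Eventually.of_forall fun x => ?_)
    change ‖η x • fderiv ℝ (U k) x v‖ ≤ B * ‖v‖ * ‖fderiv ℝ (U k) x‖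
    rw [norm_smul]
    calc ‖η x‖ * ‖fderiv ℝ (U k) x v‖ ≤ B * (‖fderiv ℝ (U k) x‖ * ‖v‖) := by
          gcongr
          · exact (norm_nonneg _).trans (hB x)
          · exact hB x
          · exact ContinuousLinearMap.le_opNorm _ _
      _ = _ := by ring
  -- Evaluation at `v` commutes with the sum only where the gradient series converges; finiteness of
  -- the integrated norms gives this almost everywhere.
  have hae : ∀ᵐ x, Summable fun k => fderiv ℝ (U k) x := by
    have h1 : ∀ᵐ x, ∑' k, ‖fderiv ℝ (U k) x‖ₑ < ⊤ := by
      refine ae_lt_top (Measurable.tsum fun k => (hdc k).measurable.enorm) ?_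
      rw [lintegral_tsum fun k => (hint k).1.enorm]
      have h : ∀ k, ∫⁻ x, ‖fderiv ℝ (U k) x‖ₑ = ENNReal.ofReal (∫ x, ‖fderiv ℝ (U k) x‖) :=
        fun k => (ofReal_integral_norm_eq_lintegral_enorm (hint k)).symm
      simp only [h]
      rw [← ENNReal.ofReal_tsum_of_nonneg
        (fun k => integral_nonneg fun a => norm_nonneg _) hsum]
      exact ENNReal.ofReal_ne_top
    filter_upwards [h1] with x hx
    have h2 := ENNReal.tsum_coe_ne_top_iff_summable.1 hx.ne
    exact Summable.of_nnnorm h2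
  have e1 : ∫ x, fderiv ℝ η x v • ∑' k, U k x = ∫ x, ∑' k, fderiv ℝ η x v • U k x :=
    integral_congr_ae (Eventually.of_forall fun x =>
      ((ha.of_norm_bounded fun k => hUa k x).tsum_const_smul _).symm)
  have e2 : ∫ x, η x • (∑' k, fderiv ℝ (U k) x) v =
      ∫ x, ∑' k, η x • fderiv ℝ (U k) x v := by
    refine integral_congr_ae ?_
    filter_upwards [hae] with x hx
    have h1 := (ContinuousLinearMap.apply ℝ (EuclideanSpace ℝ (Fin m)) v).hasSum hx.hasSum
    exact (h1.const_smul (η x)).tsum_eq.symm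
  rw [e1, e2, ← hs1.tsum_eq, ← hs2.tsum_eq, ← tsum_neg]
  exact tsum_congr fun k => by rw [hterm k, neg_neg]

/-! ### Young functions and Orlicz integrability -/

theorem IsYoung.smul_le {A : ℝ≥0 → ℝ≥0∞} (hA : IsYoung A) {c : ℝ≥0} (hc : c ≤ 1) (t : ℝ≥0) :
    A (c * t) ≤ c * A t := by
  have h := hA.convex.2 (Set.mem_univ t) (Set.mem_univ 0) (zero_le : 0 ≤ c)
    (zero_le : 0 ≤ 1 - c) (add_tsub_cancel_of_le hc)
  simpa [hA.map_zero, ENNReal.smul_def] using h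

theorem IsYoung.monotone {A : ℝ≥0 → ℝ≥0∞} (hA : IsYoung A) : Monotone A := by
  intro x y hxy
  rcases eq_or_ne y 0 with rfl | hy
  · rw [le_antisymm hxy zero_le]
  · have hc : x / y ≤ 1 := div_le_one_of_le₀ hxy zero_le
    calc A x = A (x / y * y) := by rw [div_mul_cancel₀ _ hy]
      _ ≤ (x / y : ℝ≥0) * A y := hA.smul_le hc y
      _ ≤ 1 * A y := by gcongr; exact_mod_cast hc
      _ = A y := one_mul _

/-- A Young function dominated by `tⁿ log^q t` near infinity is controlled, for `t ≤ Y`,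
by a constant plus `tⁿ log^q Y`. -/
theorem IsYoung.exists_le_of_comparable {A : ℝ≥0 → ℝ≥0∞} (hA : IsYoung A) {n : ℕ} {q : ℝ}
    (hq : 0 ≤ q) (hAq : Comparable atTop A
      (fun t : ℝ≥0 => ENNReal.ofReal ((t : ℝ) ^ n * Real.log t ^ q))) :
    ∃ K C : ℝ, 0 ≤ K ∧ 0 ≤ C ∧ ∀ (t : ℝ≥0) (Y : ℝ), 1 ≤ Y → t ≤ Y →
      A t ≤ ENNReal.ofReal (K + C * ((t : ℝ) ^ n * Real.log Y ^ q)) := by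
  obtain ⟨c, C, hc, hC, h⟩ := hAq
  obtain ⟨T₀, hT₀⟩ := eventually_atTop.1 h
  set T : ℝ≥0 := max T₀ 1 with hT
  have hup : ∀ t : ℝ≥0, T ≤ t →
      A t ≤ ENNReal.ofReal (C * ((t : ℝ) ^ n * Real.log t ^ q)) := by
    intro t ht
    refine (hT₀ t ((le_max_left _ _).trans ht)).2.trans_eq ?_
    rw [ENNReal.ofReal_mul C.coe_nonneg, ENNReal.ofReal_coe_nnreal]
  have hT1 : (1 : ℝ) ≤ T := by exact_mod_cast le_max_right T₀ 1
  have hlogT : 0 ≤ Real.log T := Real.log_nonneg hT1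
  have hK : 0 ≤ C * ((T : ℝ) ^ n * Real.log T ^ q) :=
    mul_nonneg C.coe_nonneg (mul_nonneg (by positivity) (Real.rpow_nonneg hlogT q))
  refine ⟨C * ((T : ℝ) ^ n * Real.log T ^ q), C, hK, C.coe_nonneg, fun t Y hY1 htY => ?_⟩
  have hlogY : 0 ≤ Real.log Y ^ q := Real.rpow_nonneg (Real.log_nonneg hY1) q
  rcases le_total t T with htT | hTt
  · refine ((hA.monotone htT).trans (hup T le_rfl)).trans (ENNReal.ofReal_le_ofReal ?_)
    exact le_add_of_nonneg_right (by positivity)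
  · refine (hup t hTt).trans (ENNReal.ofReal_le_ofReal ?_)
    have ht1 : (1 : ℝ) ≤ t := hT1.trans (by exact_mod_cast hTt)
    refine le_trans ?_ (le_add_of_nonneg_left hK)
    gcongr
    exact Real.log_nonneg ht1

/-- Convexity gives `A (t / r) ≤ A t / r` for `r ≥ 1`, so dividing by the larger of `1` and the
modular brings the modular below `1`; no doubling condition is needed. -/
theorem memOrlicz_of_lintegral_lt_top {X F : Type*} [MeasurableSpace X] [NormedAddCommGroup F]
    {A : ℝ≥0 → ℝ≥0∞} (hA : IsYoung A) {μ : Measure X} {f : X → F}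
    (hf : AEStronglyMeasurable f μ) (hI : ∫⁻ x, A ‖f x‖₊ ∂μ < ⊤) : MemOrlicz A μ f := by
  refine ⟨hf, ?_⟩
  obtain ⟨I, hI'⟩ : ∃ I : ℝ≥0, (I : ℝ≥0∞) = ∫⁻ x, A ‖f x‖₊ ∂μ :=
    ⟨_, ENNReal.coe_toNNReal hI.ne⟩
  set r : ℝ≥0 := max 1 I with hr
  have hr1 : 1 ≤ r := le_max_left _ _
  have hr0 : 0 < r := zero_lt_one.trans_le hr1
  have hmod : ∫⁻ x, A (‖f x‖₊ / r) ∂μ ≤ 1 := by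
    calc ∫⁻ x, A (‖f x‖₊ / r) ∂μ ≤ ∫⁻ x, (r⁻¹ : ℝ≥0) * A ‖f x‖₊ ∂μ := by
          refine lintegral_mono fun x => ?_
          rw [div_eq_inv_mul]
          exact hA.smul_le (inv_le_one_of_one_le₀ hr1) _
      _ = (r⁻¹ : ℝ≥0) * I := by rw [lintegral_const_mul' _ _ ENNReal.coe_ne_top, hI']
      _ ≤ 1 := by
          rw [← ENNReal.coe_mul]
          have : r⁻¹ * I ≤ r⁻¹ * r := by gcongr; exact le_max_right _ _
          rw [inv_mul_cancel₀ hr0.ne'] at this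
          exact_mod_cast this
  exact lt_of_le_of_lt (iInf_le_of_le r (iInf_le_of_le hr0 (iInf_le _ hmod))) ENNReal.coe_lt_top

/-! ### The map between two Cantor sets -/

section construction

variable {n : ℕ}

/-- Extension of a finite word to a sequence by the zero vertex. -/
def extendWord {k : ℕ} (w : Fin (k + 1) → Fin n → Bool) (i : ℕ) : Fin n → Bool :=
  if h : i < k + 1 then w ⟨i, h⟩ else fun _ => false

/-- The center of the cube of the Cantor set coded by a finite word. -/
noncomputable def wordCenter (s : ℕ → ℝ) {k : ℕ} (w : Fin (k + 1) → Fin n → Bool) :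
    EuclideanSpace ℝ (Fin n) :=
  digitMap s (extendWord w)

/-- The logarithmic cut-off attached to the cubes of generation `k`. -/
noncomputable def cantorCutoff (n : ℕ) (s L : ℕ → ℝ) (k : ℕ) : EuclideanSpace ℝ (Fin n) → ℝ :=
  logCutoff (2 * n * s (k + 1)) (s k / 4) (L k)

/-- The displacement produced by the cubes of generation `k`. -/
noncomputable def cantorLayer (s ρ L : ℕ → ℝ) (k : ℕ) (x : EuclideanSpace ℝ (Fin n)) :
    EuclideanSpace ℝ (Fin n) :=
  ∑ w : Fin (k + 1) → Fin n → Bool,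
    (ρ k * cantorCutoff n s L k (x - wordCenter s w)) • digitVec (w (Fin.last k))

/-- Conditions on the scales `s` of a Cantor set under which the cut-offs `cantorCutoff` have
disjoint transition regions. -/
structure IsCantorScale (n : ℕ) (s L : ℕ → ℝ) : Prop where
  one_le_dim : 1 ≤ n
  pos : ∀ k, 0 < s k
  le_one : ∀ k, s k ≤ 1
  decay : ∀ k, 128 * (n : ℝ) ^ 2 * s (k + 1) ≤ s k
  one_le_log : ∀ k, 1 ≤ L k
  log_le : ∀ k, L k ≤ Real.log (s k / s (k + 1))

theorem extendWord_of_le {k i : ℕ} (w : Fin (k + 1) → Fin n → Bool) (h : i ≤ k) :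
    extendWord w i = w ⟨i, Nat.lt_succ_of_le h⟩ :=
  dif_pos (Nat.lt_succ_of_le h)

theorem exists_extendWord_ne {k : ℕ} {w w' : Fin (k + 1) → Fin n → Bool} (h : w ≠ w') :
    ∃ i ≤ k, extendWord w i ≠ extendWord w' i := by
  obtain ⟨i, hi⟩ := Function.ne_iff.1 h
  refine ⟨i, Nat.le_of_lt_succ i.2, ?_⟩
  rwa [extendWord_of_le w (Nat.le_of_lt_succ i.2), extendWord_of_le w' (Nat.le_of_lt_succ i.2)]

namespace IsCantorScale

variable {s L : ℕ → ℝ} (h : IsCantorScale n s L)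

include h

theorem one_le_cast : (1 : ℝ) ≤ n := by exact_mod_cast h.one_le_dim

theorem decay_quarter (k : ℕ) : s (k + 1) ≤ 1 / 4 * s k := by
  have h1 := h.decay k
  have h2 := h.pos (k + 1)
  have h3 : (1 : ℝ) ≤ (n : ℝ) ^ 2 := one_le_pow₀ h.one_le_cast
  nlinarith

theorem antitone : Antitone s :=
  antitone_of_geometric_decay (by norm_num) h.pos h.decay_quarter

theorem inner_pos (k : ℕ) : 0 < 2 * n * s (k + 1) := by
  have := h.one_le_cast
  have := h.pos (k + 1)
  positivity

theorem outer_pos (k : ℕ) : 0 < s k / 4 := by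
  have := h.pos k
  positivity

theorem inner_le_outer (k : ℕ) : 2 * n * s (k + 1) ≤ s k / 4 := by
  have h1 := h.decay k
  have h2 := h.pos (k + 1)
  have h3 := h.one_le_cast
  have h4 : (n : ℝ) ≤ (n : ℝ) ^ 2 := by nlinarith
  nlinarith

theorem log_pos (k : ℕ) : 0 < L k := zero_lt_one.trans_le (h.one_le_log k)

/-- This fixes the constant in `decay`: the radii `s k / 4` and `2 n s (k+1)` produce the factor `16
· 2 · 4 n² = 128 n²`. -/
theorem log_le_log (k : ℕ) :
    L k ≤ Real.log ((s k / 4) ^ 2 / (2 * (2 * n * s (k + 1)) ^ 2)) := by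
  refine (h.log_le k).trans (Real.log_le_log (div_pos (h.pos k) (h.pos _)) ?_)
  have h1 := h.decay k
  have h2 := h.pos (k + 1)
  have h3 := h.pos k
  have h4 := h.one_le_cast
  rw [div_le_div_iff₀ h2 (by positivity)]
  calc s k * (2 * (2 * n * s (k + 1)) ^ 2)
      = s k * s (k + 1) / 16 * (128 * (n : ℝ) ^ 2 * s (k + 1)) := by ring
    _ ≤ s k * s (k + 1) / 16 * s k := by gcongr
    _ = (s k / 4) ^ 2 * s (k + 1) := by ring

theorem dist_digitMap_le {x y : ℕ → Fin n → Bool} {j : ℕ} (hxy : ∀ i < j, x i = y i) :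
    dist (digitMap s x) (digitMap s y) ≤ 4 / 3 * (n * s j) :=
  (_root_.dist_digitMap_le (by norm_num) (by norm_num) h.pos h.decay_quarter hxy).trans_eq
    (by ring)

theorem le_dist_digitMap {x y : ℕ → Fin n → Bool} {j : ℕ} (hxy : ∃ i ≤ j, x i ≠ y i) :
    2 / 3 * s j ≤ dist (digitMap s x) (digitMap s y) :=
  (_root_.le_dist_digitMap (by norm_num) (by norm_num) h.pos h.decay_quarter hxy).trans_eq'
    (by ring)

/-- Centers of one generation are at least `2/3 s k` apart, more than twice the outer radius `s k /
4`. -/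
theorem eq_of_dist_lt {k : ℕ} {w w' : Fin (k + 1) → Fin n → Bool} {x : EuclideanSpace ℝ (Fin n)}
    (hw : ‖x - wordCenter s w‖ < s k / 4) (hw' : ‖x - wordCenter s w'‖ < s k / 4) : w = w' := by
  by_contra hne
  have h1 := h.le_dist_digitMap (exists_extendWord_ne hne)
  have h2 := dist_triangle_left (wordCenter s w) (wordCenter s w') x
  rw [dist_eq_norm x, dist_eq_norm x] at h2
  unfold wordCenter at *
  linarith [h.pos k]

theorem cutoff_eq_zero {k : ℕ} {x : EuclideanSpace ℝ (Fin n)} (hx : s k / 4 ≤ ‖x‖) :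
    cantorCutoff n s L k x = 0 :=
  logCutoff_eq_zero (h.inner_pos k) (h.outer_pos k) (h.log_pos k) hx

theorem cutoff_eq_one {k : ℕ} {x : EuclideanSpace ℝ (Fin n)} (hx : ‖x‖ ≤ 2 * n * s (k + 1)) :
    cantorCutoff n s L k x = 1 :=
  logCutoff_eq_one (h.inner_pos k) (h.outer_pos k) (h.log_pos k) (h.log_le_log k) hx

theorem contDiff_cutoff (k : ℕ) : ContDiff ℝ ∞ (cantorCutoff n s L k) :=
  contDiff_logCutoff (h.inner_pos k) (h.outer_pos k)

/-- A point of the Cantor set is within `4/3 n s (k+1)` of its own center, where the cut-off is `1`,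
and at least `2/3 s k` from the others, where it is `0`. -/
theorem layer_digitMap (ρ : ℕ → ℝ) (k : ℕ) (x : ℕ → Fin n → Bool) :
    cantorLayer s ρ L k (digitMap s x) = ρ k • digitVec (x k) := by
  set w₀ : Fin (k + 1) → Fin n → Bool := fun i => x i with hw₀
  have hw₀x : ∀ i < k + 1, x i = extendWord w₀ i := fun i hi => by
    rw [extendWord_of_le w₀ (Nat.le_of_lt_succ hi)]
  unfold cantorLayer
  rw [Finset.sum_eq_single w₀]
  · rw [h.cutoff_eq_one, mul_one]
    · simp [hw₀]
    · rw [← dist_eq_norm]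
      have := h.dist_digitMap_le hw₀x
      have := h.inner_pos k
      unfold wordCenter
      linarith
  · intro w _ hw
    rw [h.cutoff_eq_zero, mul_zero, zero_smul]
    rw [← dist_eq_norm]
    obtain ⟨i, hi, hne⟩ := exists_extendWord_ne hw
    have h1 := h.le_dist_digitMap (x := x) (y := extendWord w)
      ⟨i, hi, by rw [hw₀x i (Nat.lt_succ_of_le hi)]; exact hne.symm⟩
    unfold wordCenter
    linarith [h.pos k]
  · simp

theorem norm_layer_le {ρ : ℕ → ℝ} (hρ : ∀ k, 0 < ρ k) (k : ℕ) (x : EuclideanSpace ℝ (Fin n)) :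
    ‖cantorLayer s ρ L k x‖ ≤ ρ k * n := by
  have hzero : ∀ w : Fin (k + 1) → Fin n → Bool, s k / 4 ≤ ‖x - wordCenter s w‖ →
      (ρ k * cantorCutoff n s L k (x - wordCenter s w)) • digitVec (w (Fin.last k)) = 0 :=
    fun w hw => by rw [h.cutoff_eq_zero hw, mul_zero, zero_smul]
  unfold cantorLayer
  by_cases hex : ∃ w : Fin (k + 1) → Fin n → Bool, ‖x - wordCenter s w‖ < s k / 4
  · obtain ⟨w₀, hw₀⟩ := hex
    rw [Finset.sum_eq_single w₀ (fun w _ hw => hzero w (not_lt.1 fun hlt =>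
      hw (h.eq_of_dist_lt hlt hw₀))) (by simp), norm_smul, norm_mul, Real.norm_of_nonneg (hρ k).le]
    have h1 : ‖cantorCutoff n s L k (x - wordCenter s w₀)‖ ≤ 1 := by
      rw [cantorCutoff, Real.norm_of_nonneg (logCutoff_nonneg _ _ _ _)]
      exact logCutoff_le_one _ _ _ _
    have h2 := norm_digitVec_le (w₀ (Fin.last k))
    have h3 := hρ k
    calc _ ≤ ρ k * 1 * n := by gcongr
      _ = _ := by ring
  · push Not at hex
    rw [Finset.sum_eq_zero fun w _ => hzero w (hex w), norm_zero]
    have := hρ k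
    positivity

theorem contDiff_layer (ρ : ℕ → ℝ) (k : ℕ) :
    ContDiff ℝ ∞ (cantorLayer s ρ L k : EuclideanSpace ℝ (Fin n) → _) := by
  unfold cantorLayer
  refine ContDiff.sum fun w _ => ?_
  have h1 : ContDiff ℝ ∞ fun x : EuclideanSpace ℝ (Fin n) =>
      ρ k * cantorCutoff n s L k (x - wordCenter s w) :=
    contDiff_const.mul ((h.contDiff_cutoff k).comp (contDiff_id.sub contDiff_const))
  exact h1.smul contDiff_const

theorem fderiv_layer (ρ : ℕ → ℝ) (k : ℕ) (x : EuclideanSpace ℝ (Fin n)) :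
    fderiv ℝ (cantorLayer s ρ L k) x = ∑ w : Fin (k + 1) → Fin n → Bool,
      (ρ k • fderiv ℝ (cantorCutoff n s L k) (x - wordCenter s w)).smulRight
        (digitVec (w (Fin.last k))) := by
  refine HasFDerivAt.fderiv ?_
  refine HasFDerivAt.fun_sum fun w _ => HasFDerivAt.smul_const (HasFDerivAt.const_mul ?_ _) _
  have h1 := ((h.contDiff_cutoff k).differentiable (by simp) (x - wordCenter s w)).hasFDerivAt
  have h2 := h1.comp x ((hasFDerivAt_id x).sub_const (wordCenter s w))
  rw [ContinuousLinearMap.comp_id] at h2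
  exact h2

theorem exists_of_fderiv_layer_ne_zero {C : ℝ}
    (hC : ∀ t, |deriv Real.smoothTransition t| ≤ C) {ρ : ℕ → ℝ} (hρ : ∀ k, 0 < ρ k) {k : ℕ}
    {x : EuclideanSpace ℝ (Fin n)} (hx : fderiv ℝ (cantorLayer s ρ L k) x ≠ 0) :
    ∃ w : Fin (k + 1) → Fin n → Bool, 2 * n * s (k + 1) < ‖x - wordCenter s w‖ ∧
      ‖x - wordCenter s w‖ < s k / 4 ∧
      ‖fderiv ℝ (cantorLayer s ρ L k) x‖ ≤
        2 * C * n * (ρ k / L k * ‖x - wordCenter s w‖⁻¹) := by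
  have hzero : ∀ w : Fin (k + 1) → Fin n → Bool, (¬ (2 * n * s (k + 1) < ‖x - wordCenter s w‖ ∧
      ‖x - wordCenter s w‖ < s k / 4)) →
      (ρ k • fderiv ℝ (cantorCutoff n s L k) (x - wordCenter s w)).smulRight
        (digitVec (w (Fin.last k))) = 0 := by
    intro w hw
    have h0 : fderiv ℝ (cantorCutoff n s L k) (x - wordCenter s w) = 0 := by
      by_cases h1 : 2 * n * s (k + 1) < ‖x - wordCenter s w‖
      · exact fderiv_logCutoff_eq_zero_of_le (h.inner_pos k) (h.outer_pos k) (h.log_pos k)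
          (not_lt.1 fun h2 => hw ⟨h1, h2⟩)
      · exact fderiv_logCutoff_eq_zero_of_ge (h.inner_pos k) (h.outer_pos k) (h.log_pos k)
          (h.log_le_log k) (not_lt.1 h1)
    rw [h0]
    ext
    simp
  have hsum := h.fderiv_layer ρ k x
  obtain ⟨w₀, h1, h2⟩ : ∃ w : Fin (k + 1) → Fin n → Bool,
      2 * n * s (k + 1) < ‖x - wordCenter s w‖ ∧ ‖x - wordCenter s w‖ < s k / 4 := by
    by_contra hcon
    rw [not_exists] at hcon
    exact hx (hsum.trans (Finset.sum_eq_zero fun w _ => hzero w (hcon w)))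
  refine ⟨w₀, h1, h2, ?_⟩
  rw [hsum, Finset.sum_eq_single w₀ (fun w _ hw => hzero w fun hlt =>
    hw (h.eq_of_dist_lt hlt.2 h2)) (by simp), ContinuousLinearMap.norm_smulRight_apply,
    norm_smul, Real.norm_of_nonneg (hρ k).le]
  have hne : x - wordCenter s w₀ ≠ 0 := norm_pos_iff.1 ((h.inner_pos k).trans h1)
  have h3 := norm_fderiv_logCutoff_le hC (h.inner_pos k) (h.outer_pos k) (h.log_pos k) hne
  have h4 := norm_digitVec_le (w₀ (Fin.last k))
  have h5 := hρ k
  have h6 := h.log_pos k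
  have h7 := norm_pos_iff.2 hne
  have hC0 : 0 ≤ C := (abs_nonneg _).trans (hC 0)
  calc _ ≤ ρ k * (2 * C / (L k * ‖x - wordCenter s w₀‖)) * n := by
        gcongr
        exact h3
    _ = _ := by field_simp

/-- A transition of layer `l` lies within `s (k+1) / 4` of a center of generation `l`. If that
center extends the word of layer `k`, the point falls in the inner ball of layer `k`; otherwise
separation keeps it out of the outer ball. -/
theorem fderiv_layer_disjoint {ρ : ℕ → ℝ} (hρ : ∀ k, 0 < ρ k) {k l : ℕ} (hkl : k < l)
    {x : EuclideanSpace ℝ (Fin n)} (hx : fderiv ℝ (cantorLayer s ρ L k) x ≠ 0) :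
    fderiv ℝ (cantorLayer s ρ L l) x = 0 := by
  by_contra hl
  obtain ⟨C, -, hC⟩ := Real.smoothTransition.exists_abs_deriv_le
  obtain ⟨w, hw1, hw2, -⟩ := h.exists_of_fderiv_layer_ne_zero hC hρ hx
  obtain ⟨w', -, hw', -⟩ := h.exists_of_fderiv_layer_ne_zero hC hρ hl
  have hsl : s l ≤ s (k + 1) := h.antitone hkl
  have hsk : s (k + 1) ≤ s k := h.antitone (Nat.le_succ k)
  have hn := h.one_le_cast
  have hpos := h.pos (k + 1)
  by_cases hpre : ∃ i ≤ k, extendWord w i ≠ extendWord w' i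
  · have h1 := h.le_dist_digitMap hpre
    have h2 := dist_triangle_left (wordCenter s w) (wordCenter s w') x
    rw [dist_eq_norm x, dist_eq_norm x] at h2
    unfold wordCenter at *
    linarith
  · push Not at hpre
    have h1 := h.dist_digitMap_le (j := k + 1) (x := extendWord w') (y := extendWord w)
      fun i hi => (hpre i (Nat.le_of_lt_succ hi)).symm
    have h2 := dist_triangle x (wordCenter s w') (wordCenter s w)
    rw [dist_eq_norm x, dist_eq_norm x] at h2
    unfold wordCenter at *
    nlinarith

/-- This replaces subadditivity of `A`, which is not available: the modular of the sum is at most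
the sum of the modulars. -/
theorem exists_tsum_fderiv_layer_eq {ρ : ℕ → ℝ} (hρ : ∀ k, 0 < ρ k)
    (x : EuclideanSpace ℝ (Fin n)) :
    ∃ k, ∑' j, fderiv ℝ (cantorLayer s ρ L j) x = fderiv ℝ (cantorLayer s ρ L k) x := by
  by_cases hex : ∃ k, fderiv ℝ (cantorLayer s ρ L k) x ≠ 0
  · obtain ⟨k, hk⟩ := hex
    refine ⟨k, tsum_eq_single k fun j hj => ?_⟩
    rcases lt_or_gt_of_ne hj with hlt | hlt
    · by_contra hne
      exact hk (h.fderiv_layer_disjoint hρ hlt hne)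
    · exact h.fderiv_layer_disjoint hρ hlt hk
  · push Not at hex
    exact ⟨0, by simp [hex]⟩

/-- The series of the displacements `cantorLayer` maps a Cantor set with scales `s` to one with
scales `ρ`, and belongs to the Orlicz-Sobolev space when the energies are summable. -/
theorem exists_memOrliczSobolev {ρ : ℕ → ℝ} (hρ : ∀ k, 0 < ρ k) (hρ1 : ∀ k, ρ k ≤ 1)
    (hρs : Summable ρ) {q : ℝ} (hq : 0 ≤ q)
    (henergy : ∀ c : ℝ, 1 ≤ c → Summable fun k => ((2 : ℝ) ^ n) ^ (k + 1) *
      ((ρ k / L k) ^ n * (c + Real.log (1 / s (k + 1))) ^ q * Real.log (1 / s (k + 1))))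
    {A : ℝ≥0 → ℝ≥0∞} (hA : IsYoung A) (hAq : Comparable atTop A
      (fun t : ℝ≥0 => ENNReal.ofReal ((t : ℝ) ^ n * Real.log t ^ q))) :
    ∃ u : EuclideanSpace ℝ (Fin n) → EuclideanSpace ℝ (Fin n), Continuous u ∧
      MemOrliczSobolev A u ∧ ∀ x, u (digitMap s x) = digitMap ρ x := by
  obtain ⟨C, hC0, hC⟩ := Real.smoothTransition.exists_abs_deriv_le
  obtain ⟨K, B, hK, hB, hAle⟩ := hA.exists_le_of_comparable hq hAq
  have hn := h.one_le_cast
  set D : ℝ := 2 * C * n with hD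
  have hD0 : 0 < D := by positivity
  -- The gradient of layer `k` is at most `(1 + D) / s (k+1)`; `c` absorbs the logarithm of `1 + D`,
  -- and its leading `1` keeps the `q`-th power at least `1`.
  set c : ℝ := 1 + Real.log (1 + D) with hc
  have hc1 : 1 ≤ c := le_add_of_nonneg_right (Real.log_nonneg (by linarith))
  set M : ℕ → ℝ := fun k => (ρ k / L k) ^ n * (c + Real.log (1 / s (k + 1))) ^ q with hM
  set H : ℕ → EuclideanSpace ℝ (Fin n) → ℝ := fun k x => ∑ w : Fin (k + 1) → Fin n → Bool,
    annulusMajorant n (2 * n * s (k + 1)) (s k / 4) (M k) ‖x - wordCenter s w‖ with hH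
  have hlog0 : ∀ k, 0 ≤ Real.log (1 / s k) := fun k =>
    Real.log_nonneg ((one_le_div (h.pos k)).2 (h.le_one k))
  have hQ1 : ∀ k, 1 ≤ (c + Real.log (1 / s (k + 1))) ^ q := fun k =>
    Real.one_le_rpow (by linarith [hlog0 (k + 1)]) hq
  have hM0 : ∀ k, 0 ≤ M k := fun k => by
    have := hρ k
    have := h.log_pos k
    have := hQ1 k
    exact mul_nonneg (by positivity) (by linarith)
  have hann0 : ∀ k (t : ℝ), 0 ≤ annulusMajorant n (2 * n * s (k + 1)) (s k / 4) (M k) t :=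
    fun k t => annulusMajorant_nonneg (h.inner_pos k) (hM0 k)
  have hH0 : ∀ k x, 0 ≤ H k x := fun k x => Finset.sum_nonneg fun w _ => hann0 k _
  -- pointwise bounds
  set C₁ : ℝ := 1 + D ^ n with hC₁
  set C₂ : ℝ := K + B * D ^ n with hC₂
  have hC₂0 : 0 ≤ C₂ := by positivity
  have hpt : ∀ k x, ‖fderiv ℝ (cantorLayer s ρ L k) x‖ ≤ C₁ * H k x ∧
      A ‖fderiv ℝ (cantorLayer s ρ L k) x‖₊ ≤ ENNReal.ofReal (C₂ * H k x) := by
    intro k x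
    by_cases hx : fderiv ℝ (cantorLayer s ρ L k) x = 0
    · rw [hx]
      simp only [norm_zero, nnnorm_zero, hA.map_zero, zero_le, and_true]
      exact mul_nonneg (by positivity) (hH0 k x)
    obtain ⟨w, hw1, hw2, hw3⟩ := h.exists_of_fderiv_layer_ne_zero hC hρ hx
    set d := ‖x - wordCenter s w‖ with hd
    set t := ‖fderiv ℝ (cantorLayer s ρ L k) x‖ with ht
    have ht0 : 0 ≤ t := norm_nonneg _
    have hd0 : 0 < d := (h.inner_pos k).trans hw1
    have hL0 := h.log_pos k
    have hρk := hρ k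
    have hQ := hQ1 k
    have hs1 := h.pos (k + 1)
    have hHge : 1 + M k * (d ^ n)⁻¹ ≤ H k x := by
      have h1 : annulusMajorant n (2 * n * s (k + 1)) (s k / 4) (M k) d
          = 1 + M k * (d ^ n)⁻¹ := Set.indicator_of_mem (Set.mem_Ioo.2 ⟨hw1, hw2⟩) _
      rw [← h1]
      exact Finset.single_le_sum (f := fun w => annulusMajorant n (2 * n * s (k + 1)) (s k / 4)
        (M k) ‖x - wordCenter s w‖) (fun w _ => hann0 k _) (Finset.mem_univ w)
    have htn : t ^ n * (c + Real.log (1 / s (k + 1))) ^ q ≤ D ^ n * (M k * (d ^ n)⁻¹) := by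
      calc t ^ n * (c + Real.log (1 / s (k + 1))) ^ q
          ≤ (D * (ρ k / L k * d⁻¹)) ^ n * (c + Real.log (1 / s (k + 1))) ^ q := by gcongr
        _ = D ^ n * (M k * (d ^ n)⁻¹) := by
          simp only [hM]
          rw [mul_pow D, mul_pow _ d⁻¹, inv_pow]
          ring
    have hMd : 0 ≤ M k * (d ^ n)⁻¹ := mul_nonneg (hM0 k) (by positivity)
    constructor
    · have h1 : t ≤ 1 + t ^ n := by
        rcases le_total t 1 with ht1 | ht1
        · have : 0 ≤ t ^ n := by positivity
          linarith
        · have := le_self_pow₀ ht1 (by have := h.one_le_dim; omega : n ≠ 0)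
          linarith
      have h2 : t ^ n ≤ t ^ n * (c + Real.log (1 / s (k + 1))) ^ q :=
        le_mul_of_one_le_right (by positivity) hQ
      have hDn : 0 ≤ D ^ n := by positivity
      calc t ≤ 1 + D ^ n * (M k * (d ^ n)⁻¹) := by linarith
        _ ≤ C₁ * (1 + M k * (d ^ n)⁻¹) := by rw [hC₁]; nlinarith
        _ ≤ C₁ * H k x := by gcongr
    · have hY1 : 1 ≤ (1 + D) / s (k + 1) := by
        rw [one_le_div hs1]
        linarith [h.le_one (k + 1)]
      have htY : t ≤ (1 + D) / s (k + 1) := by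
        have h1 : ρ k / L k ≤ 1 := by
          rw [div_le_one hL0]
          exact (hρ1 k).trans (h.one_le_log k)
        have h2 : d⁻¹ ≤ (s (k + 1))⁻¹ := by
          gcongr
          nlinarith
        calc t ≤ D * (ρ k / L k * d⁻¹) := hw3
          _ ≤ (1 + D) * (1 * (s (k + 1))⁻¹) := by
            gcongr
            linarith
          _ = _ := by rw [one_mul, div_eq_mul_inv]
      have hlogY : Real.log ((1 + D) / s (k + 1)) ^ q ≤
          (c + Real.log (1 / s (k + 1))) ^ q := by
        refine Real.rpow_le_rpow (Real.log_nonneg hY1) ?_ hq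
        rw [div_eq_mul_one_div, Real.log_mul (by positivity) (by positivity), hc]
        linarith
      refine (hAle _ _ hY1 (by simpa using htY)).trans (ENNReal.ofReal_le_ofReal ?_)
      rw [coe_nnnorm, ← ht]
      have hDn : 0 ≤ D ^ n := by positivity
      calc K + B * (t ^ n * Real.log ((1 + D) / s (k + 1)) ^ q)
          ≤ K + B * (t ^ n * (c + Real.log (1 / s (k + 1))) ^ q) := by gcongr
        _ ≤ K + B * (D ^ n * (M k * (d ^ n)⁻¹)) := by gcongr
        _ ≤ C₂ * (1 + M k * (d ^ n)⁻¹) := by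
          have h1 : 0 ≤ B * D ^ n := by positivity
          rw [hC₂]
          nlinarith [mul_nonneg hK hMd]
        _ ≤ C₂ * H k x := by gcongr
  -- integral bounds
  set V : ℝ := n * volume.real (Metric.ball (0 : EuclideanSpace ℝ (Fin n)) 1) with hV
  have hV0 : 0 ≤ V := by positivity
  have hHint : ∀ k, Integrable (H k) ∧ ∫ x, H k x ≤ V * (((2 : ℝ) ^ n) ^ (k + 1) * s k ^ n +
      ((2 : ℝ) ^ n) ^ (k + 1) * (M k * Real.log (1 / s (k + 1)))) := by
    intro k
    obtain ⟨hi, hle⟩ := integral_annulusMajorant_le h.one_le_dim (h.inner_pos k)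
      (h.inner_le_outer k)
    have hiw : ∀ w : Fin (k + 1) → Fin n → Bool, Integrable fun x =>
        annulusMajorant n (2 * n * s (k + 1)) (s k / 4) (M k) ‖x - wordCenter s w‖ :=
      fun w => hi.comp_sub_right _
    refine ⟨integrable_finsetSum _ fun w _ => hiw w, ?_⟩
    have hs0 := h.pos k
    have hs1 := h.pos (k + 1)
    have hV1 : V * ((s k / 4) ^ n + M k * Real.log (s k / 4 / (2 * n * s (k + 1)))) ≤
        V * (s k ^ n + M k * Real.log (1 / s (k + 1))) := by
      have h1 : s k / 4 / (2 * n * s (k + 1)) ≤ 1 / s (k + 1) := by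
        have := h.le_one k
        gcongr
        · linarith
        · nlinarith
      have h2 : 0 < s k / 4 / (2 * n * s (k + 1)) := div_pos (h.outer_pos k) (h.inner_pos k)
      have h3 := hM0 k
      gcongr
      linarith
    rw [integral_finsetSum _ fun w _ => hiw w]
    calc _ ≤ ∑ w : Fin (k + 1) → Fin n → Bool,
          V * (s k ^ n + M k * Real.log (1 / s (k + 1))) := by
          refine Finset.sum_le_sum fun w _ => ?_
          rw [integral_sub_right_eq_self (fun x : EuclideanSpace ℝ (Fin n) =>
            annulusMajorant n (2 * n * s (k + 1)) (s k / 4) (M k) ‖x‖) (wordCenter s w)]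
          exact hle.trans hV1
      _ = _ := by
          simp
          ring
  have hsumH : Summable fun k => ∫ x, H k x := by
    refine Summable.of_nonneg_of_le (fun k => integral_nonneg (hH0 k)) (fun k => (hHint k).2)
      (Summable.mul_left V (Summable.add ?_ (henergy c hc1)))
    -- The `1` in the majorant costs the total volume of the balls, `2^(n(k+1)) (s k)^n` up to a
    -- constant, which `s k ≤ 4^(-k)` makes summable.
    have hgeo : Summable fun k : ℕ => (2 : ℝ) ^ n * (1 / 2 : ℝ) ^ k :=
      summable_geometric_two.mul_left _
    refine Summable.of_nonneg_of_le (fun k => ?_) (fun k => ?_) hgeo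
    · have := h.pos k
      positivity
    · have h1 : s k ≤ (1 / 4 : ℝ) ^ k := by
        have := geometric_decay (by norm_num) h.decay_quarter 0 k
        rw [zero_add] at this
        exact this.trans (mul_le_of_le_one_right (by positivity) (h.le_one 0))
      have h2 := h.pos k
      calc ((2 : ℝ) ^ n) ^ (k + 1) * s k ^ n
          ≤ ((2 : ℝ) ^ n) ^ (k + 1) * ((1 / 4 : ℝ) ^ k) ^ n := by gcongr
        _ = (2 : ℝ) ^ n * ((1 / 2 : ℝ) ^ k) ^ n := by
          rw [pow_succ', mul_assoc, ← pow_mul, ← pow_mul, ← pow_mul, mul_comm n k, ← mul_pow]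
          norm_num
        _ ≤ (2 : ℝ) ^ n * (1 / 2 : ℝ) ^ k := by
          gcongr
          exact pow_le_of_le_one (by positivity)
            (pow_le_one₀ (by norm_num) (by norm_num)) (by have := h.one_le_dim; omega)
  have hcd : ∀ k, ContDiff ℝ 1 (cantorLayer s ρ L k : EuclideanSpace ℝ (Fin n) → _) :=
    fun k => (h.contDiff_layer ρ k).of_le (by exact_mod_cast le_top)
  have hbound : ∀ k x, ‖cantorLayer s ρ L k x‖ ≤ ρ k * n := h.norm_layer_le hρ
  have hfi : ∀ k, Integrable
      (fderiv ℝ (cantorLayer s ρ L k : EuclideanSpace ℝ (Fin n) → _)) := fun k =>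
    ((hHint k).1.const_mul C₁).mono'
      ((hcd k).continuous_fderiv one_ne_zero).aestronglyMeasurable
      (Eventually.of_forall fun x => (hpt k x).1)
  have hgrad := isWeakGradient_tsum hcd (hρs.mul_right (n : ℝ)) hbound hfi <|
    Summable.of_nonneg_of_le (fun k => integral_nonneg fun x => norm_nonneg _)
      (fun k => (integral_mono (hfi k).norm ((hHint k).1.const_mul C₁)
        fun x => (hpt k x).1).trans_eq (integral_const_mul _ _)) (hsumH.mul_left C₁)
  refine ⟨fun x => ∑' k, cantorLayer s ρ L k x, ?_, ⟨_, hgrad, ?_⟩, fun x => ?_⟩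
  · exact continuous_tsum (fun k => (hcd k).continuous) (hρs.mul_right (n : ℝ)) hbound
  · refine memOrlicz_of_lintegral_lt_top hA hgrad.locallyIntegrable_gradient.aestronglyMeasurable ?_
    calc _ ≤ ∫⁻ x, ∑' k, ENNReal.ofReal (C₂ * H k x) := by
          refine lintegral_mono fun x => ?_
          obtain ⟨k, hk⟩ := h.exists_tsum_fderiv_layer_eq hρ x
          simp only [hk]
          exact (hpt k x).2.trans (ENNReal.le_tsum k)
      _ = ∑' k, ENNReal.ofReal (C₂ * ∫ x, H k x) := by
          rw [lintegral_tsum fun k =>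
            ((hHint k).1.const_mul C₂).1.aemeasurable.ennreal_ofReal]
          refine tsum_congr fun k => ?_
          rw [← integral_const_mul, ofReal_integral_eq_lintegral_ofReal
            ((hHint k).1.const_mul C₂) (Eventually.of_forall fun x => mul_nonneg hC₂0 (hH0 k x))]
      _ < ⊤ := by
          rw [← ENNReal.ofReal_tsum_of_nonneg
            (fun k => mul_nonneg hC₂0 (integral_nonneg (hH0 k))) (hsumH.mul_left C₂)]
          exact ENNReal.ofReal_lt_top
  · simp only [h.layer_digitMap ρ]
    exact (hasSum_digitMap hρ hρs x).tsum_eq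

end IsCantorScale

end construction

/-! ### Gauges along the two sequences of scales -/

theorem tendsto_toNNReal_nhdsGT_zero {s : ℕ → ℝ} (hs0 : ∀ k, 0 < s k)
    (hs : Tendsto s atTop (𝓝 0)) :
    Tendsto (fun k => (s k).toNNReal) atTop (𝓝[>] (0 : ℝ≥0)) := by
  refine tendsto_nhdsWithin_iff.2 ⟨?_, Eventually.of_forall fun k => ?_⟩
  · simpa [Function.comp_def] using (continuous_real_toNNReal.tendsto 0).comp hs
  · simpa using hs0 k

/-- A gauge comparable to `log^β (1/r)`, evaluated at scales `e · exp (-κ Λʲ)`, is comparable to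
`(Λ^β)ʲ`. -/
theorem exists_gauge_exp_bounds {φ : ℝ≥0 → ℝ≥0} {β κ Λ e : ℝ} (hβ : β < 0) (hκ : 0 < κ)
    (hΛ : 1 < Λ) (he : 0 < e)
    (hφβ : Comparable (𝓝[>] (0 : ℝ≥0)) (fun r => (φ r : ℝ≥0∞))
      (fun r : ℝ≥0 => ENNReal.ofReal (Real.log (1 / (r : ℝ)) ^ β))) :
    ∃ m M : ℝ≥0, 0 < m ∧ ∀ᶠ j : ℕ in atTop,
      m ≤ φ (e * Real.exp (-(κ * Λ ^ j))).toNNReal * (((Λ ^ β) ^ j)⁻¹).toNNReal ∧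
      (((Λ ^ β) ^ j)⁻¹).toNNReal * φ (e * Real.exp (-(κ * Λ ^ j))).toNNReal ≤ M := by
  obtain ⟨c, C, hc, hC, h⟩ := hφβ
  have hΛ0 : 0 < Λ := by linarith
  have hgrow : Tendsto (fun j : ℕ => κ * Λ ^ j) atTop atTop :=
    (tendsto_pow_atTop_atTop_of_one_lt hΛ).const_mul_atTop hκ
  have hlim : Tendsto (fun j : ℕ => e * Real.exp (-(κ * Λ ^ j))) atTop (𝓝 0) := by
    have := (Real.tendsto_exp_neg_atTop_nhds_zero.comp hgrow).const_mul e
    rwa [mul_zero] at this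
  have hcomp := (tendsto_toNNReal_nhdsGT_zero (fun j => by positivity) hlim).eventually h
  -- Eventually `log (1/r)` lies between `(κ/2) Λ^j` and `2 κ Λ^j`; as `β < 0`, the larger factor
  -- gives the lower bound.
  refine ⟨c * ((2 * κ) ^ β).toNNReal, C * ((κ / 2) ^ β).toNNReal,
    mul_pos hc (by simpa using Real.rpow_pos_of_pos (by positivity) β), ?_⟩
  filter_upwards [hcomp, hgrow.eventually_ge_atTop (2 * |Real.log e|)] with j hj hbig
  have hx0 : 0 < κ * Λ ^ j := by positivity
  have hlog : Real.log (1 / (((e * Real.exp (-(κ * Λ ^ j))).toNNReal : ℝ≥0) : ℝ)) =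
      κ * Λ ^ j - Real.log e := by
    rw [Real.coe_toNNReal _ (by positivity), one_div, Real.log_inv,
      Real.log_mul he.ne' (Real.exp_pos _).ne', Real.log_exp]
    ring
  have hab := abs_le.1 (le_refl |Real.log e|)
  have hpow : ∀ d : ℝ, 0 < d → (d * Λ ^ j) ^ β = d ^ β * (Λ ^ β) ^ j := fun d hd => by
    rw [Real.mul_rpow hd.le (by positivity), ← Real.rpow_natCast, ← Real.rpow_natCast,
      ← Real.rpow_mul hΛ0.le, ← Real.rpow_mul hΛ0.le, mul_comm (j : ℝ)]
  have hlow : (2 * κ) ^ β * (Λ ^ β) ^ j ≤ (κ * Λ ^ j - Real.log e) ^ β := by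
    rw [← hpow _ (by positivity)]
    exact Real.rpow_le_rpow_of_nonpos (by linarith) (by linarith) hβ.le
  have hupp : (κ * Λ ^ j - Real.log e) ^ β ≤ (κ / 2) ^ β * (Λ ^ β) ^ j := by
    rw [← hpow _ (by positivity)]
    exact Real.rpow_le_rpow_of_nonpos (by positivity) (by linarith) hβ.le
  rw [hlog] at hj
  have hP : 0 < (Λ ^ β) ^ j := by positivity
  set f := φ (e * Real.exp (-(κ * Λ ^ j))).toNNReal with hf
  have h1 : (c : ℝ) * (κ * Λ ^ j - Real.log e) ^ β ≤ f := by
    have := hj.1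
    rw [← ENNReal.ofReal_coe_nnreal (p := c), ← ENNReal.ofReal_mul c.coe_nonneg,
      ← ENNReal.ofReal_coe_nnreal (p := f), ENNReal.ofReal_le_ofReal_iff f.coe_nonneg] at this
    exact this
  have h2 : (f : ℝ) ≤ C * (κ * Λ ^ j - Real.log e) ^ β := by
    have := hj.2
    have hnn : 0 ≤ (κ * Λ ^ j - Real.log e) ^ β := le_trans (by positivity) hlow
    rw [← ENNReal.ofReal_coe_nnreal (p := C), ← ENNReal.ofReal_mul C.coe_nonneg,
      ← ENNReal.ofReal_coe_nnreal (p := f),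
      ENNReal.ofReal_le_ofReal_iff (mul_nonneg C.coe_nonneg hnn)] at this
    exact this
  constructor
  · rw [← NNReal.coe_le_coe, NNReal.coe_mul, NNReal.coe_mul,
      Real.coe_toNNReal _ (by positivity), Real.coe_toNNReal _ (by positivity),
      ← div_eq_mul_inv, le_div_iff₀ hP]
    calc c * (2 * κ) ^ β * (Λ ^ β) ^ j = c * ((2 * κ) ^ β * (Λ ^ β) ^ j) := by ring
      _ ≤ c * (κ * Λ ^ j - Real.log e) ^ β := by gcongr
      _ ≤ f := h1
  · rw [← NNReal.coe_le_coe, NNReal.coe_mul, NNReal.coe_mul,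
      Real.coe_toNNReal _ (by positivity), Real.coe_toNNReal _ (by positivity),
      inv_mul_le_iff₀ hP]
    calc (f : ℝ) ≤ C * (κ * Λ ^ j - Real.log e) ^ β := h2
      _ ≤ C * ((κ / 2) ^ β * (Λ ^ β) ^ j) := by gcongr
      _ = _ := by ring

/-- A gauge comparable to `r^σ log^μ (1/r)`, with `μ > 1 + σ`, evaluated at scales
`e · θʲ (j + 1)^(-(1 + 1/σ))`, is much larger than `(θ^σ)ʲ`. -/
theorem eventually_le_gauge_geometric {Φ : ℝ≥0 → ℝ≥0} {σ μ θ e : ℝ} (hσ : 0 < σ)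
    (hμ : 1 + σ < μ) (hθ0 : 0 < θ) (hθ1 : θ < 1) (he : 0 < e)
    (hρ : Tendsto (fun j : ℕ => θ ^ j * ((j : ℝ) + 1) ^ (-(1 + 1 / σ))) atTop (𝓝 0))
    (hΦμ : Comparable (𝓝[>] (0 : ℝ≥0)) (fun r => (Φ r : ℝ≥0∞))
      (fun r : ℝ≥0 => ENNReal.ofReal ((r : ℝ) ^ σ * Real.log (1 / (r : ℝ)) ^ μ))) (M : ℝ≥0) :
    ∀ᶠ j : ℕ in atTop, M ≤ Φ (e * (θ ^ j * ((j : ℝ) + 1) ^ (-(1 + 1 / σ)))).toNNReal *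
      (((θ ^ σ) ^ j)⁻¹).toNNReal := by
  obtain ⟨c, C, hc, hC, h⟩ := hΦμ
  have hlim : Tendsto (fun j : ℕ => e * (θ ^ j * ((j : ℝ) + 1) ^ (-(1 + 1 / σ)))) atTop (𝓝 0) := by
    have := hρ.const_mul e
    rwa [mul_zero] at this
  have hcomp := (tendsto_toNNReal_nhdsGT_zero (fun j => by positivity) hlim).eventually h
  -- Half the exponential rate of `θ^j`; the other half absorbs `log e` and the shift from `j` to `j
  -- + 1`.
  set l : ℝ := -Real.log θ / 2 with hl
  have hl0 : 0 < l := by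
    have := Real.log_neg hθ0 hθ1
    rw [hl]
    linarith
  have hc0 : (0 : ℝ) < c := hc
  have hj1 : Tendsto (fun j : ℕ => (j : ℝ) + 1) atTop atTop :=
    tendsto_natCast_atTop_atTop.atTop_add tendsto_const_nhds
  have hbig : Tendsto (fun j : ℕ => c * e ^ σ * l ^ μ * ((j : ℝ) + 1) ^ (μ - (1 + σ)))
      atTop atTop :=
    ((tendsto_rpow_atTop (by linarith)).comp hj1).const_mul_atTop (by positivity)
  have hlin : Tendsto (fun j : ℕ => l * (j : ℝ)) atTop atTop :=
    tendsto_natCast_atTop_atTop.const_mul_atTop hl0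
  filter_upwards [hcomp, hbig.eventually_ge_atTop (M : ℝ),
    hlin.eventually_ge_atTop (l + Real.log e)] with j hj hM hlj
  set y : ℝ := (j : ℝ) + 1 with hy
  have hy1 : 1 ≤ y := by rw [hy]; linarith [Nat.cast_nonneg (α := ℝ) j]
  have hy0 : 0 < y := by linarith
  set r : ℝ := e * (θ ^ j * y ^ (-(1 + 1 / σ))) with hr
  have hr0 : 0 < r := by positivity
  have hlog : l * y ≤ Real.log (1 / r) := by
    have h1 : 0 ≤ Real.log y := Real.log_nonneg hy1
    have h2 : 0 ≤ (1 + 1 / σ) * Real.log y := by positivity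
    rw [one_div, Real.log_inv, hr, Real.log_mul he.ne' (by positivity),
      Real.log_mul (by positivity) (by positivity), Real.log_pow, Real.log_rpow hy0]
    have h3 : Real.log θ = -2 * l := by rw [hl]; ring
    rw [h3, hy]
    rw [hy] at h2
    nlinarith
  have hrσ : r ^ σ = e ^ σ * ((θ ^ σ) ^ j * y ^ (-(1 + σ))) := by
    rw [hr, Real.mul_rpow he.le (by positivity), Real.mul_rpow (by positivity) (by positivity),
      ← Real.rpow_mul hy0.le, ← Real.rpow_natCast, ← Real.rpow_natCast, ← Real.rpow_mul hθ0.le,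
      ← Real.rpow_mul hθ0.le, mul_comm (j : ℝ)]
    congr 3
    field_simp
    ring
  have h1 : (c : ℝ) * (r ^ σ * Real.log (1 / r) ^ μ) ≤ Φ r.toNNReal := by
    have := hj.1
    rw [Real.coe_toNNReal _ hr0.le, ← ENNReal.ofReal_coe_nnreal (p := c),
      ← ENNReal.ofReal_mul c.coe_nonneg, ← ENNReal.ofReal_coe_nnreal (p := Φ r.toNNReal),
      ENNReal.ofReal_le_ofReal_iff (NNReal.coe_nonneg _)] at this
    exact this
  have hP : 0 < (θ ^ σ) ^ j := by positivity
  rw [← NNReal.coe_le_coe, NNReal.coe_mul, Real.coe_toNNReal _ (by positivity),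
    ← div_eq_mul_inv, le_div_iff₀ hP]
  calc (M : ℝ) * (θ ^ σ) ^ j ≤ (c * e ^ σ * l ^ μ * y ^ (μ - (1 + σ))) * (θ ^ σ) ^ j := by
        gcongr
    _ = c * (e ^ σ * ((θ ^ σ) ^ j * y ^ (-(1 + σ))) * (l * y) ^ μ) := by
        rw [sub_eq_add_neg, Real.rpow_add hy0, Real.mul_rpow hl0.le hy0.le]
        ring
    _ ≤ c * (r ^ σ * Real.log (1 / r) ^ μ) := by
        rw [hrσ]
        gcongr
        linarith
    _ ≤ Φ r.toNNReal := h1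

/-! ### Choice of scales and conclusion -/

/-- The doubly exponential scales of the Cantor set in the domain. -/
theorem isCantorScale_exp {n : ℕ} (hn : 1 ≤ n) {Λ : ℝ} (hΛ : 1 < Λ) :
    IsCantorScale n
      (fun k => Real.exp (-(Real.log (128 * (n : ℝ) ^ 2) / (Λ - 1) * Λ ^ k)))
      (fun k => Real.log (128 * (n : ℝ) ^ 2) * Λ ^ k) := by
  have hn1 : (1 : ℝ) ≤ n := by exact_mod_cast hn
  have hn2 : (1 : ℝ) ≤ (n : ℝ) ^ 2 := one_le_pow₀ hn1
  have hK : 1 ≤ Real.log (128 * (n : ℝ) ^ 2) := by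
    rw [Real.le_log_iff_exp_le (by positivity)]
    linarith [Real.exp_one_lt_d9]
  set K := Real.log (128 * (n : ℝ) ^ 2) with hKdef
  have hΛ1 : 0 < Λ - 1 := by linarith
  have hpow : ∀ k : ℕ, 1 ≤ Λ ^ k := fun k => one_le_pow₀ hΛ.le
  have hdiff : ∀ k : ℕ, K / (Λ - 1) * Λ ^ (k + 1) - K / (Λ - 1) * Λ ^ k = K * Λ ^ k := by
    -- The factor `1 / (Λ - 1)` makes `log (s k / s (k+1))` equal to `K Λ^k`, so the bound `log_le`
    -- holds with equality and `decay` is sharp at `k = 0`.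
    intro k
    field_simp
    ring
  refine ⟨hn, fun k => Real.exp_pos _, fun k => ?_, fun k => ?_, fun k => ?_, fun k => ?_⟩
  · rw [Real.exp_le_one_iff, neg_nonpos]
    have := hpow k
    positivity
  · have h1 : 128 * (n : ℝ) ^ 2 = Real.exp K := (Real.exp_log (by positivity)).symm
    rw [h1, ← Real.exp_add, Real.exp_le_exp]
    have := hdiff k
    have := hpow k
    nlinarith
  · have := hpow k
    nlinarith
  · rw [← Real.exp_sub, Real.log_exp]
    linarith [hdiff k]

/-- Every factor is geometric in `k` except the power of `k + 1`. Under `hcrit` the geometric ratios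
multiply to `1`, and `a > 1` makes the remaining series converge. -/
theorem summable_cantor_energy {n : ℕ} (hn : 1 ≤ n) {q θ Λ K κ a c : ℝ} (hq : 0 ≤ q) (hθ : 0 < θ)
    (hΛ : 1 < Λ) (hK : 0 < K) (hκ : 0 < κ) (ha : 1 < a) (hc : 1 ≤ c)
    (hcrit : 2 ^ n * θ ^ n * (Λ ^ n)⁻¹ * Λ ^ q * Λ = 1) :
    Summable fun k : ℕ => ((2 : ℝ) ^ n) ^ (k + 1) *
      ((θ ^ k * ((k : ℝ) + 1) ^ (-a) / (K * Λ ^ k)) ^ n *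
        (c + κ * Λ ^ (k + 1)) ^ q * (κ * Λ ^ (k + 1))) := by
  have hΛ0 : 0 < Λ := by linarith
  have hsum : Summable fun k : ℕ => ((k : ℝ) + 1) ^ (-a) := by
    have := (summable_nat_add_iff 1).2 (Real.summable_nat_rpow.2 (by linarith : -a < -1))
    simpa using this
  refine Summable.of_nonneg_of_le (fun k => by positivity) (fun k => ?_)
    (hsum.mul_left (2 ^ n * (K⁻¹) ^ n * (c + κ) ^ q * Λ ^ q * (κ * Λ)))
  have hk1 : (1 : ℝ) ≤ (k : ℝ) + 1 := by linarith [Nat.cast_nonneg (α := ℝ) k]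
  set z : ℝ := ((k : ℝ) + 1) ^ (-a) with hz
  have hz0 : 0 < z := by positivity
  have hz1 : z ≤ 1 := Real.rpow_le_one_of_one_le_of_nonpos hk1 (by linarith)
  have hpow : 1 ≤ Λ ^ (k + 1) := one_le_pow₀ hΛ.le
  have hQ : (c + κ * Λ ^ (k + 1)) ^ q ≤ (c + κ) ^ q * Λ ^ q * (Λ ^ q) ^ k := by
    calc (c + κ * Λ ^ (k + 1)) ^ q ≤ ((c + κ) * Λ ^ (k + 1)) ^ q := by
          gcongr
          nlinarith
      _ = (c + κ) ^ q * (Λ ^ q) ^ (k + 1) := by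
          rw [Real.mul_rpow (by positivity) (by positivity), ← Real.rpow_natCast,
            ← Real.rpow_natCast, ← Real.rpow_mul hΛ0.le, ← Real.rpow_mul hΛ0.le,
            mul_comm ((k + 1 : ℕ) : ℝ)]
      _ = _ := by ring
  calc ((2 : ℝ) ^ n) ^ (k + 1) * ((θ ^ k * z / (K * Λ ^ k)) ^ n *
        (c + κ * Λ ^ (k + 1)) ^ q * (κ * Λ ^ (k + 1)))
      ≤ ((2 : ℝ) ^ n) ^ (k + 1) * ((θ ^ k * z / (K * Λ ^ k)) ^ n *
        ((c + κ) ^ q * Λ ^ q * (Λ ^ q) ^ k) * (κ * Λ ^ (k + 1))) := by gcongr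
    _ = 2 ^ n * (K⁻¹) ^ n * (c + κ) ^ q * Λ ^ q * (κ * Λ) *
        ((2 ^ n * θ ^ n * (Λ ^ n)⁻¹ * Λ ^ q * Λ) ^ k * z ^ n) := by
        have e1 : (θ ^ k * z / (K * Λ ^ k)) ^ n =
            (θ ^ n) ^ k * z ^ n * (K⁻¹) ^ n * ((Λ ^ n)⁻¹) ^ k := by
          rw [div_eq_mul_inv, mul_inv, mul_pow, mul_pow, mul_pow, ← pow_mul, ← pow_mul,
            mul_comm k n, ← inv_pow Λ n, ← pow_mul, ← inv_pow Λ k, ← pow_mul, mul_comm k n]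
          ring
        rw [e1, mul_pow, mul_pow, mul_pow, mul_pow]
        ring
    _ ≤ 2 ^ n * (K⁻¹) ^ n * (c + κ) ^ q * Λ ^ q * (κ * Λ) * z := by
        rw [hcrit, one_pow, one_mul]
        gcongr
        exact pow_le_of_le_one hz0.le hz1 (by omega)

theorem theorem5p3 (n : ℕ) (hn : 1 ≤ n) (q β σ μ : ℝ) (hq : (n : ℝ) - 1 < q) (hβ : β < 0)
    (hσ : σ = n * β / (n - q - 1 + β)) (hμ : 1 + σ < μ)
    (A : ℝ≥0 → ℝ≥0∞) (hA : IsYoung A)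
    (hAq : Comparable atTop A
      (fun t : ℝ≥0 => ENNReal.ofReal ((t : ℝ) ^ n * Real.log t ^ q)))
    (φ : ℝ≥0 → ℝ≥0) (hφ : IsGauge φ)
    (hφβ : Comparable (𝓝[>] (0 : ℝ≥0)) (fun r => (φ r : ℝ≥0∞))
      (fun r : ℝ≥0 => ENNReal.ofReal (Real.log (1 / (r : ℝ)) ^ β)))
    (Φ : ℝ≥0 → ℝ≥0) (hΦ : IsGauge Φ)
    (hΦμ : Comparable (𝓝[>] (0 : ℝ≥0)) (fun r => (Φ r : ℝ≥0∞))
      (fun r : ℝ≥0 => ENNReal.ofReal ((r : ℝ) ^ σ * Real.log (1 / (r : ℝ)) ^ μ))) :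
    ∃ (u : EuclideanSpace ℝ (Fin n) → EuclideanSpace ℝ (Fin n))
      (E : Set (EuclideanSpace ℝ (Fin n))),
      Continuous u ∧ MemOrliczSobolev A u ∧ IsCompact E ∧
      0 < gaugeHausdorff φ E ∧ gaugeHausdorff φ E < ⊤ ∧
      gaugeHausdorff Φ (u '' E) = ⊤ := by
  have hn1 : (1 : ℝ) ≤ n := by exact_mod_cast hn
  have hn0 : (0 : ℝ) < n := by linarith
  have hden : (n : ℝ) - q - 1 + β < 0 := by linarith
  have hσ0 : 0 < σ := by
    rw [hσ]
    exact div_pos_of_neg_of_neg (mul_neg_of_pos_of_neg hn0 hβ) hden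
  -- Equivalent to `q > n - 1`; it yields `θ < 1/2`, which separates the cubes of the image.
  have hσn : σ < n := by
    rw [hσ, div_lt_iff_of_neg hden]
    nlinarith
  have hnσ : (n : ℝ) / σ = (n - q - 1 + β) / β := by
    rw [hσ]
    have := hden.ne
    field_simp
  -- scales
  set Λ : ℝ := 2 ^ (-(n : ℝ) / β) with hΛdef
  have hΛ : 1 < Λ := Real.one_lt_rpow one_lt_two (div_pos_of_neg_of_neg (by linarith) hβ)
  have hΛ0 : 0 < Λ := by linarith
  have hΛβ : Λ ^ β = (2 ^ n : ℝ)⁻¹ := by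
    rw [hΛdef, ← Real.rpow_mul two_pos.le, div_mul_cancel₀ _ hβ.ne, Real.rpow_neg two_pos.le,
      Real.rpow_natCast]
  set θ : ℝ := 2 ^ (-((n : ℝ) / σ)) with hθdef
  have hθ0 : 0 < θ := by positivity
  have hθ : θ < 1 / 2 := by
    have h1 : 1 < (n : ℝ) / σ := (one_lt_div hσ0).2 hσn
    calc θ < 2 ^ (-1 : ℝ) := Real.rpow_lt_rpow_of_exponent_lt one_lt_two (by linarith)
      _ = 1 / 2 := by rw [Real.rpow_neg_one, one_div]
  have hθσ : θ ^ σ = (2 ^ n : ℝ)⁻¹ := by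
    rw [hθdef, ← Real.rpow_mul two_pos.le, neg_mul, div_mul_cancel₀ _ hσ0.ne',
      Real.rpow_neg two_pos.le, Real.rpow_natCast]
  -- Taking logarithms in base `2`, this is the identity `hnσ`, that is, the definition of `σ`.
  have hcrit : 2 ^ n * θ ^ n * (Λ ^ n)⁻¹ * Λ ^ q * Λ = 1 := by
    have e1 : Λ ^ n = 2 ^ (-(n : ℝ) / β * n) := by
      rw [Real.rpow_mul two_pos.le, Real.rpow_natCast]
    have e2 : Λ ^ q = 2 ^ (-(n : ℝ) / β * q) := (Real.rpow_mul two_pos.le _ _).symm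
    have e3 : θ ^ n = 2 ^ (-((n : ℝ) / σ) * n) := by
      rw [Real.rpow_mul two_pos.le, Real.rpow_natCast]
    rw [e1, e2, e3, hΛdef, ← Real.rpow_natCast 2 n, ← Real.rpow_neg two_pos.le,
      ← Real.rpow_add two_pos, ← Real.rpow_add two_pos, ← Real.rpow_add two_pos,
      ← Real.rpow_add two_pos, hnσ, ← Real.rpow_zero 2]
    congr 1
    have := hβ.ne
    field_simp
    ring
  set K := Real.log (128 * (n : ℝ) ^ 2) with hK
  have hK0 : 0 < K := Real.log_pos (by nlinarith)
  set κ := K / (Λ - 1) with hκ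
  have hκ0 : 0 < κ := div_pos hK0 (by linarith)
  set s : ℕ → ℝ := fun k => Real.exp (-(κ * Λ ^ k)) with hs
  have hS : IsCantorScale n s fun k => K * Λ ^ k := isCantorScale_exp hn hΛ
  -- Large enough for a convergent energy since `a > 1`, small enough for infinite measure since `a
  -- σ = 1 + σ < μ`.
  set a : ℝ := 1 + 1 / σ with ha
  have ha1 : 1 < a := lt_add_of_pos_right _ (by positivity)
  set ρ : ℕ → ℝ := fun k => θ ^ k * ((k : ℝ) + 1) ^ (-a) with hρ
  have hρ0 : ∀ k, 0 < ρ k := fun k => by positivity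
  have hρd : ∀ k, ρ (k + 1) ≤ θ * ρ k := fun k => by
    have h1 : ((k + 1 : ℕ) + 1 : ℝ) ^ (-a) ≤ ((k : ℝ) + 1) ^ (-a) :=
      Real.rpow_le_rpow_of_nonpos (by positivity) (by push_cast; linarith) (by linarith)
    calc ρ (k + 1) ≤ θ ^ (k + 1) * ((k : ℝ) + 1) ^ (-a) := by
          simp only [hρ]
          gcongr
      _ = θ * ρ k := by simp only [hρ]; ring
  have hρa : Antitone ρ := antitone_of_geometric_decay (by linarith) hρ0 hρd
  have hρ1 : ∀ k, ρ k ≤ 1 := fun k => (hρa (Nat.zero_le k)).trans (by simp [hρ])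
  have hρs : Summable ρ := summable_of_geometric_decay hθ0.le (by linarith) hρ0 hρd
  have hss : Summable s :=
    summable_of_geometric_decay (by norm_num) (by norm_num) hS.pos hS.decay_quarter
  obtain ⟨u, huc, huA, hu⟩ := hS.exists_memOrliczSobolev hρ0 hρ1 hρs (by linarith : 0 ≤ q)
    (fun c hc => by
      have := summable_cantor_energy hn (by linarith : 0 ≤ q) hθ0 hΛ hK0 hκ0 ha1 hc hcrit
      simpa [hs, hρ, Real.log_inv] using this) hA hAq
  have hcard : (Fintype.card (Fin n → Bool) : ℝ≥0) = (2 ^ n : ℝ).toNNReal := by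
    simp [Real.toNNReal_pow]
  have hpowN : ∀ j : ℕ, ((((2 ^ n : ℝ)⁻¹) ^ j)⁻¹).toNNReal =
      (Fintype.card (Fin n → Bool) : ℝ≥0) ^ j := fun j => by
    rw [hcard, inv_pow, inv_inv, Real.toNNReal_pow (by positivity)]
  have hnt : Nontrivial (Fin n → Bool) :=
    haveI : Nonempty (Fin n) := ⟨⟨0, hn⟩⟩
    inferInstance
  have hzero : ∀ {t : ℕ → ℝ} (e : ℝ), Summable t →
      Tendsto (fun j => (e * t j).toNNReal) atTop (𝓝 0) := fun {t} e ht => by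
    simpa [Function.comp_def] using (continuous_real_toNNReal.tendsto _).comp (ht.tendsto_atTop_zero.const_mul e)
  have hanti : ∀ {t : ℕ → ℝ} {e : ℝ}, 0 ≤ e → Antitone t →
      Antitone fun j => (e * t j).toNNReal := fun he ht i j hij =>
    Real.toNNReal_le_toNNReal (mul_le_mul_of_nonneg_left (ht hij) he)
  refine ⟨u, Set.range (digitMap s), huc, huA,
    isCompact_range (continuous_digitMap hS.pos hss), ?_, ?_, ?_⟩
  · obtain ⟨m, _, hm0, hm⟩ := exists_gauge_exp_bounds (e := 2 / 3) hβ hκ0 hΛ (by norm_num) hφβ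
    refine lt_of_lt_of_le (ENNReal.coe_pos.2 hm0) (le_gaugeHausdorff_range hφ _
      (fun j => (2 / 3 * s j).toNNReal) (fun j => by have := hS.pos j; simpa using this)
      (hanti (by norm_num) hS.antitone) (hzero _ hss) (fun x y j hxy => ?_) m ?_)
    · rw [Real.toNNReal_le_iff_le_coe, coe_nndist]
      exact hS.le_dist_digitMap hxy
    · filter_upwards [hm] with j hj
      rw [hΛβ, hpowN] at hj
      exact hj.1
  · obtain ⟨_, M, _, hM⟩ := exists_gauge_exp_bounds (e := 4 / 3 * n) hβ hκ0 hΛ (by positivity) hφβ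
    refine lt_of_le_of_lt (gaugeHausdorff_range_le hφ _
      (fun j => (4 / 3 * n * s j).toNNReal) (hzero _ hss) (fun x y j hxy => ?_) M ?_)
      ENNReal.coe_lt_top
    · rw [← NNReal.coe_le_coe, coe_nndist,
        Real.coe_toNNReal _ (mul_nonneg (by positivity) (hS.pos j).le), mul_assoc]
      exact hS.dist_digitMap_le hxy
    · filter_upwards [hM] with j hj
      rw [hΛβ, hpowN] at hj
      exact hj.2
  · have himg : u '' Set.range (digitMap s) = Set.range (digitMap ρ) := by
      rw [← Set.range_comp]
      exact congrArg Set.range (funext hu)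
    rw [himg]
    -- The mass distribution bound holds with every constant `M`, since the gauge at the scales `ρ`
    -- eventually outgrows `M · 2^(-nj)`.
    refine ENNReal.eq_top_of_forall_nnreal_le fun M => ?_
    have he : 0 < (1 - 2 * θ) / (1 - θ) := div_pos (by linarith) (by linarith)
    refine le_gaugeHausdorff_range hΦ _ (fun j => ((1 - 2 * θ) / (1 - θ) * ρ j).toNNReal)
      (fun j => Real.toNNReal_pos.2 (mul_pos he (hρ0 j))) (hanti he.le hρa) (hzero _ hρs)
      (fun x y j hxy => ?_) M ?_
    · rw [Real.toNNReal_le_iff_le_coe, coe_nndist, mul_comm]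
      exact le_dist_digitMap hθ0.le hθ hρ0 hρd hxy
    · have := eventually_le_gauge_geometric hσ0 hμ hθ0 (by linarith) he
        hρs.tendsto_atTop_zero hΦμ M
      rw [hθσ] at this
      simpa only [hpowN] using this
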